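/- Let $k$ be a field, $d,n\ge 1$ integers, and $\underline\ell=(\ell_0,\dots,\ell_{n-1})$ a Kupisch series: positive integers with $\ell_i\ge 2$ for $i\ne 0$ and $\ell_{i+1}\le \ell_i+1$ for all $i$ (indices modulo $n$). *The algebras.* Let $A^{(d)}$ be the incidence $k$-category of $\mathbb Z^d$ with the product order, and let $\mathbf{os}^{(d)}=\{\mu\in\mathbb Z^d:\mu_1\ge\dots\ge\mu_d\}$. Put $$\mathbf{os}^{(d)}_{\underline\ell}=\{\mu\in\mathbf{os}^{(d)}: n-1\ge\mu_1,\ \mu_d\ge 0,\ \mu_1-\mu_d+1\le\ell_{\mu_1}\},\qquad \mathbf{os}^{(d)}_{\tilde{\underline\ell}}=\{\mu\in\mathbf{os}^{(d)}:\mu_1-\mu_d+1\le\tilde\ell_{\mu_1}\},$$ where $\tilde\ell$ is the $n$-periodic extension of $\underline\ell$ to $\mathbb Z$. The higher Nakayama algebra $A^{(d)}_{\underline\ell}$ is the idempotent quotient of $A^{(d)}$ by the objects outside $\mathbf{os}^{(d)}_{\underline\ell}$, and $\tilde A^{(d)}_{\underline\ell}$ is the idempotent quotient of the orbit category of $A^{(d)}$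 under translation by $(n,\dots,n)$ by the objects outside (the image of) $\mathbf{os}^{(d)}_{\tilde{\underline\ell}}$; for $d=1$ one divides out in addition the paths from $i-\tilde\ell_i$ to $i$, so that one obtains the Nakayama algebras with Kupisch series $\underline\ell$. Modules are finite dimensional, and the projective at a vertex $y$ is spanned by the morphisms ending at $y$. *The subcategories.* For $\lambda\in\mathbf{os}^{(d+1)}_{\underline\ell}$ (respectively $\lambda\in\mathbf{os}^{(d+1)}_{\tilde{\underline\ell}}$) let $M_\lambda$ be the interval module: it has a copy of $k$ at each vertex of the interval $[(\lambda_2,\dots,\lambda_{d+1}),(\lambda_1,\dots,\lambda_d)]$, identity maps between these copies and $0$ elsewhere (respectively the push-down of this module to the orbit category). Let $\mathcal M$ (respectively $\tilde{\mathcal M}$) be the $d$-cluster-tilting subcategory formed by the direct summands of finite direct sums of interval modules. *The $\mathrm{Ext}^d$-quiver.* A non-zero object $S$ of an additive category is Schur simple if every non-zero morphism $X\to S$ is an epimorphism and every non-zero morphism $S\to Y$ is a monomorphism. The $\mathrm{Ext}^d$-quiver of a full subcategory of an abelian $k$-category has as vertices the isomorphism classes of Schur simple objects of the subcategory, and $\dim_k\mathrm{Ext}^d(S,S')$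 arrows $[S]\to[S']$, where $\mathrm{Ext}^d$ is taken in the abelian category. **Proposition.** If $\ell_0=1$, then the $\mathrm{Ext}^d$-quiver of $\mathcal M\subseteq\operatorname{mod}A^{(d)}_{\underline\ell}$ is isomorphic to the linearly oriented quiver $\mathbb A_n\colon 0\to1\to\cdots\to n-1$. If $\ell_0\ne1$, then the $\mathrm{Ext}^d$-quiver of $\tilde{\mathcal M}\subseteq\operatorname{mod}\tilde A^{(d)}_{\underline\ell}$ is isomorphic to the cyclically oriented quiver $\tilde{\mathbb A}_{n-1}\colon 0\to1\to\cdots\to n-1\to0$ (a single loop if $n=1$). -/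

import Mathlib

open CategoryTheory CategoryTheory.Limits

universe u v w

namespace HigherNakayama

noncomputable section

/-! ### Finite dimensional modules over a `k`-algebra -/

section FiniteDimensionalModules

open scoped ModuleCat

variable (k : Type u) [Field k] (A : Type u) [Ring A] [Algebra k A]

/-- The property of a left `A`-module of being finite dimensional over `k`. -/
def isFinDim : ObjectProperty (ModuleCat.{u} A) := fun M => Module.Finite k M

/-- The category `mod A` of finite dimensional left `A`-modules. -/
abbrev FinMod := (isFinDim k A).FullSubcategory

instance : (isFinDim k A).IsClosedUnderSubobjects where
  prop_of_mono {X Y} f _ hY := by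
    have hY' : Module.Finite k Y := hY
    exact Module.Finite.of_injective (f.hom.restrictScalars k)
      ((ModuleCat.mono_iff_injective f).1 inferInstance)

instance : (isFinDim k A).IsClosedUnderQuotients where
  prop_of_epi {X Y} f _ hX := by
    have hX' : Module.Finite k X := hX
    exact Module.Finite.of_surjective (f.hom.restrictScalars k)
      ((ModuleCat.epi_iff_surjective f).1 inferInstance)

instance : (isFinDim k A).ContainsZero where
  exists_zero := ⟨ModuleCat.of A PUnit, ModuleCat.isZero_of_subsingleton _, by
    have : Finite (ModuleCat.of A PUnit.{u + 1}) := inferInstanceAs (Finite PUnit)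
    exact (Module.Finite.of_finite : Module.Finite k (ModuleCat.of A PUnit.{u + 1}))⟩

instance : (isFinDim k A).IsClosedUnderFiniteProducts := by
  have : (isFinDim k A).IsClosedUnderBinaryProducts := by
    refine ObjectProperty.IsClosedUnderLimitsOfShape.mk' ?_
    rintro _ ⟨F, hF⟩
    have h1 : Module.Finite k (F.obj ⟨.left⟩) := hF _
    have h2 : Module.Finite k (F.obj ⟨.right⟩) := hF _
    let p := LinearMap.prod ((limit.π F ⟨.left⟩).hom.restrictScalars k)
      ((limit.π F ⟨.right⟩).hom.restrictScalars k)
    refine Module.Finite.of_injective p ?_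
    intro x y hxy
    have e1 : limit.π F ⟨.left⟩ x = limit.π F ⟨.left⟩ y := congrArg Prod.fst hxy
    have e2 : limit.π F ⟨.right⟩ x = limit.π F ⟨.right⟩ y := congrArg Prod.snd hxy
    exact Concrete.limit_ext F x y (by rintro ⟨_ | _⟩ <;> assumption)
  exact ObjectProperty.IsClosedUnderFiniteProducts.mk'

theorem isFinDim_of_surjective (M : ModuleCat.{u} A) {V : Type u} [AddCommGroup V] [Module k V]
    [Module.Finite k V] (e : V →+ M) (he : ∀ (c : k) (v : V), e (c • v) = algebraMap k A c • e v)
    (hs : Function.Surjective e) : isFinDim k A M := by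
  let e' : V →ₗ[k] M := { e with map_smul' := he }
  exact Module.Finite.of_surjective e' hs

end FiniteDimensionalModules

/-! ### Schur simples and the `Ext^d`-quiver -/

/-- A non-zero object `S` is Schur simple if every non-zero morphism to `S` is an epimorphism
and every non-zero morphism from `S` is a monomorphism. -/
def IsSchurSimple {C : Type v} [Category.{w} C] [Preadditive C] : ObjectProperty C := fun S =>
  ¬ IsZero S ∧ (∀ ⦃X : C⦄ (f : X ⟶ S), f ≠ 0 → Epi f) ∧ (∀ ⦃Y : C⦄ (f : S ⟶ Y), f ≠ 0 → Mono f)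

/-- The additive hull of a family of objects: the direct summands of finite direct sums of
members of the family. -/
def addHull {C : Type v} [Category.{w} C] [Abelian C] {ι : Type*} (F : ι → C) :
    ObjectProperty C := fun X =>
  haveI := Abelian.hasFiniteBiproducts (C := C)
  ∃ (m : ℕ) (σ : Fin m → ι), Nonempty (Retract X (⨁ fun i => F (σ i)))

section ExtQuiver

variable (k : Type u) [Field k] {C : Type v} [Category.{w} C] [Abelian C] [Linear k C]

/-- The dimension of `Ext^d(X, Y)`, as a cardinal. -/
def extDim (d : ℕ) (X Y : C) : Cardinal :=
  letI : HasExt.{max v w} C := HasExt.standard C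
  Module.rank k (Abelian.Ext X Y d)

/-- The vertices of the `Ext^d`-quiver of a full subcategory `M`: the isomorphism classes of
Schur simple objects of the category `M`. -/
def ExtQuiver (_k : Type u) (_d : ℕ) (M : ObjectProperty C) : Type _ :=
  Quotient (isIsomorphicSetoid (IsSchurSimple (C := M.FullSubcategory)).FullSubcategory)

/-- An object of the ambient abelian category in the given isomorphism class. -/
def ExtQuiver.rep {d : ℕ} {M : ObjectProperty C} (x : ExtQuiver k d M) : C :=
  (Quotient.out x).obj.obj

/-- The arrows `[S] → [S']` form a set of cardinality `dim_k Ext^d(S, S')`. -/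
instance (d : ℕ) (M : ObjectProperty C) : Quiver (ExtQuiver k d M) where
  Hom x y := (extDim k d x.rep y.rep).out

end ExtQuiver

/-- An isomorphism of quivers. -/
structure QuiverIso (V : Type*) (W : Type*) [Quiver V] [Quiver W] where
  /-- the bijection on vertices -/
  obj : V ≃ W
  /-- the bijections on arrows -/
  hom : ∀ a b : V, (a ⟶ b) ≃ (obj a ⟶ obj b)

/-- The linearly oriented quiver `0 → 1 → ⋯ → n - 1`. -/
def LinearQuiver (n : ℕ) : Type := Fin n

instance (n : ℕ) : Quiver (LinearQuiver n) where
  Hom i j := PLift ((i : Fin n).val + 1 = (j : Fin n).val)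

/-- The cyclically oriented quiver `0 → 1 → ⋯ → n - 1 → 0`; a loop if `n = 1`. -/
def CyclicQuiver (n : ℕ) : Type := Fin n

instance (n : ℕ) : Quiver (CyclicQuiver n) where
  Hom i j := PLift (((i : Fin n).val + 1) % n = (j : Fin n).val)

/-! ### The algebras -/

section Algebras

variable (k : Type u) [Field k] (d : ℕ)

/-- The incidence algebra of `ℤ^d` with the product order consists of the (possibly infinite)
linear combinations of the morphisms `x → y`, one for each pair `x ≤ y`, of the incidence category.
Products are written in the order in which paths are traversed, so that left modules are the
contravariant representations, and the projective at a vertex `y` is spanned by the morphisms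
ending at `y`. The elements invariant under translation by `(s, …, s)` form a subalgebra. Such an
element is determined by its values on the pairs `(x, y)` up to simultaneous translation, that is,
on the morphisms of the orbit category. For `s = 0` every element is invariant. -/
def orbitAlgebra (s : ℤ) : Subalgebra k (IncidenceAlgebra k (Fin d → ℤ)) where
  carrier := {f | ∀ x y : Fin d → ℤ, f (fun i => x i + s) (fun i => y i + s) = f x y}
  mul_mem' {f g} hf hg := by
    intro x y
    simp only [Set.mem_ofPred_eq] at hf hg
    simp only [IncidenceAlgebra.mul_apply]
    refine Finset.sum_nbij' (fun z i => z i - s) (fun z i => z i + s) ?_ ?_ ?_ ?_ ?_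
    · intro z hz
      simp only [Finset.mem_Icc, Pi.le_def] at hz ⊢
      exact ⟨fun i => by linarith [hz.1 i], fun i => by linarith [hz.2 i]⟩
    · intro z hz
      simp only [Finset.mem_Icc, Pi.le_def] at hz ⊢
      exact ⟨fun i => by linarith [hz.1 i], fun i => by linarith [hz.2 i]⟩
    · intro z _; ext i; simp
    · intro z _; ext i; simp
    · intro z _
      rw [← hf x, ← hg _ y]
      simp
  add_mem' {f g} hf hg := by
    intro x y
    simp only [Set.mem_ofPred_eq] at hf hg
    simp [IncidenceAlgebra.add_apply, hf x y, hg x y]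
  algebraMap_mem' c := by
    intro x y
    have h : ((fun i => x i + s) = fun i => y i + s) ↔ x = y := by
      simp [funext_iff]
    simp [Algebra.algebraMap_eq_smul_one, IncidenceAlgebra.constSMul_apply, h]

/-- The elements to be divided out: the linear combinations of identities of vertices outside the
set `U` and, for `d = 1` only, the linear combinations of the paths `i - ℓ i ⇝ i`. -/
def relations (s : ℤ) (U : Set (Fin d → ℤ)) (ℓ : ℤ → ℕ) : Set (orbitAlgebra k d s) :=
  {f | ∀ x y, f.1 x y ≠ 0 → x = y ∧ x ∉ U} ∪
  {f | d = 1 ∧ ∀ x y, f.1 x y ≠ 0 → ∀ i, x i = y i - ℓ (y i)}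

/-- The idempotent quotient, at the vertices outside `U`, of the incidence category of `ℤ^d` modulo
translation by `(s, …, s)`; for `d = 1` also modulo the paths `i - ℓ i ⇝ i`. Below, `U` has only
finitely many vertices up to translation, and the quotient is then the finite dimensional algebra
spanned by the (classes of) morphisms `x → y` with `[x, y] ⊆ U` (and `y - x < ℓ y` if `d = 1`). -/
abbrev QuotientAlgebra (s : ℤ) (U : Set (Fin d → ℤ)) (ℓ : ℤ → ℕ) : Type u :=
  (TwoSidedIdeal.span (relations k d s U ℓ)).ringCon.Quotient

variable {d}

/-- The operator `(f • v) x = ∑ y ∈ [a, b], f x y * v y` as a matrix. -/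
def intervalMatrix (a b : Fin d → ℤ) (f : IncidenceAlgebra k (Fin d → ℤ)) :
    Matrix (Set.Icc a b) (Set.Icc a b) k :=
  Matrix.of fun x y => f x.1 y.1

theorem intervalMatrix_mul (a b : Fin d → ℤ) (f g : IncidenceAlgebra k (Fin d → ℤ)) :
    intervalMatrix k a b (f * g) = intervalMatrix k a b f * intervalMatrix k a b g := by
  classical
  ext x z
  simp only [intervalMatrix, Matrix.of_apply, IncidenceAlgebra.mul_apply, Matrix.mul_apply]
  symm
  rw [← Finset.sum_subset (Finset.subset_univ
    (Finset.univ.filter fun y : Set.Icc a b => x.1 ≤ y.1 ∧ y.1 ≤ z.1))]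
  · refine Finset.sum_bij (fun y _ => y.1) ?_ ?_ ?_ ?_
    · intro y hy
      simpa using hy
    · intro y _ y' _ h
      exact Subtype.ext h
    · intro y hy
      rw [Finset.mem_Icc] at hy
      exact ⟨⟨y, x.2.1.trans hy.1, hy.2.trans z.2.2⟩, Finset.mem_filter.2 ⟨Finset.mem_univ _, hy⟩, rfl⟩
    · intro y _
      rfl
  · intro y _ hy
    simp only [Finset.mem_filter, Finset.mem_univ, true_and, not_and_or] at hy
    rcases hy with hy | hy
    · rw [IncidenceAlgebra.apply_eq_zero_of_not_le hy, zero_mul]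
    · rw [IncidenceAlgebra.apply_eq_zero_of_not_le hy, mul_zero]

/-- The representation of the incidence algebra on the functions on the interval `[a, b]`. -/
def incidenceAction (a b : Fin d → ℤ) :
    IncidenceAlgebra k (Fin d → ℤ) →ₐ[k] Matrix (Set.Icc a b) (Set.Icc a b) k :=
  AlgHom.ofLinearMap
    { toFun := intervalMatrix k a b
      map_add' := fun f g => by ext x y; simp [intervalMatrix]
      map_smul' := fun c f => by
        ext x y; simp [intervalMatrix, IncidenceAlgebra.constSMul_apply] }
    (by ext x y; simp [intervalMatrix, Matrix.one_apply, Subtype.ext_iff])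
    (intervalMatrix_mul k a b)

/-- The vector space with one basis vector for each vertex of the interval `[a, b]`. -/
def IntervalSpace (a b : Fin d → ℤ) : Type u := Set.Icc a b → k

instance (a b : Fin d → ℤ) : AddCommGroup (IntervalSpace k a b) :=
  inferInstanceAs (AddCommGroup (Set.Icc a b → k))

instance (a b : Fin d → ℤ) : Module k (IntervalSpace k a b) :=
  inferInstanceAs (Module k (Set.Icc a b → k))

instance (a b : Fin d → ℤ) : Module.Finite k (IntervalSpace k a b) :=
  inferInstanceAs (Module.Finite k (Set.Icc a b → k))

variable {k}

/-- The interval `[a, b]` supports a module over the quotient algebra: the relations act as zero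
on the functions on `[a, b]`. -/
def IsAdmissibleInterval (k : Type u) [Field k] (s : ℤ) (U : Set (Fin d → ℤ)) (ℓ : ℤ → ℕ)
    (a b : Fin d → ℤ) : Prop :=
  ∀ f ∈ relations k d s U ℓ, ∀ x ∈ Set.Icc a b, ∀ y ∈ Set.Icc a b, f.1 x y = 0

variable {s : ℤ} {U : Set (Fin d → ℤ)} {ℓ : ℤ → ℕ} {a b : Fin d → ℤ}

/-- The action of the quotient algebra on the functions on `[a, b]`. -/
def intervalAction (h : IsAdmissibleInterval k s U ℓ a b) :
    QuotientAlgebra k d s U ℓ →ₐ[k] Module.End k (IntervalSpace k a b) :=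
  (Matrix.toLinAlgEquiv' (R := k) (n := Set.Icc a b)).toAlgHom.comp
    (RingCon.liftₐ _ ((incidenceAction k a b).comp (orbitAlgebra k d s).val) (by
      have hle : TwoSidedIdeal.span (relations k d s U ℓ) ≤
          ⟨RingCon.ker ((incidenceAction k a b).comp (orbitAlgebra k d s).val).toRingHom⟩ := by
        rw [TwoSidedIdeal.span_le]
        intro f hf
        change intervalMatrix k a b f.1 = intervalMatrix k a b 0
        ext x y
        exact h f hf x.1 x.2 y.1 y.2
      exact TwoSidedIdeal.ringCon_le_iff.1 hle))

/-- The resulting module structure. -/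
@[reducible] def intervalModuleStructure (h : IsAdmissibleInterval k s U ℓ a b) :
    Module (QuotientAlgebra k d s U ℓ) (IntervalSpace k a b) :=
  Module.compHom _ (intervalAction h).toRingHom

theorem interval_isFinDim (h : IsAdmissibleInterval k s U ℓ a b) :
    letI := intervalModuleStructure h
    isFinDim k _ (ModuleCat.of (QuotientAlgebra k d s U ℓ) (IntervalSpace k a b)) := by
  let _ := intervalModuleStructure h
  refine isFinDim_of_surjective k _
    (ModuleCat.of (QuotientAlgebra k d s U ℓ) (IntervalSpace k a b))
    (V := IntervalSpace k a b) (AddMonoidHom.id _) (fun c v => ?_) fun v => ⟨v, rfl⟩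
  change c • v = intervalAction h (algebraMap k _ c) v
  rw [AlgHom.commutes]
  rfl

/-- The functions on `[a, b]` as a finite dimensional module over the quotient algebra. For
`s ≠ 0` it is the push-down, to the orbit category, of the representation with a copy of `k` on
each vertex of `[a, b]`, identities between them, and `0` elsewhere. -/
def intervalModule (h : IsAdmissibleInterval k s U ℓ a b) :
    FinMod k (QuotientAlgebra k d s U ℓ) where
  obj :=
    letI := intervalModuleStructure h
    ModuleCat.of (QuotientAlgebra k d s U ℓ) (IntervalSpace k a b)
  property := interval_isFinDim h

end Algebras

/-! ### Kupisch series and higher Nakayama algebras -/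

section Nakayama

/-- Kupisch series of connected Nakayama algebras, given as admissible quotients of the path
algebra of the linear quiver (`ℓ 0 = 1`) or of the cyclic quiver (`ℓ 0 ≠ 1`): the dimensions of
the indecomposable projectives `P_0, …, P_{n-1}`. In `step`, the index `i + 1` is taken modulo
`n`. -/
structure IsKupisch {n : ℕ} [NeZero n] (ℓ : Fin n → ℕ) : Prop where
  pos : 1 ≤ ℓ 0
  two_le : ∀ i, i ≠ 0 → 2 ≤ ℓ i
  step : ∀ i, ℓ (i + 1) ≤ ℓ i + 1

variable {n : ℕ} [NeZero n]

/-- The `n`-periodic extension of `ℓ` to `ℤ`. -/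
def periodicExt (ℓ : Fin n → ℕ) (i : ℤ) : ℕ :=
  ℓ ⟨(i % n).toNat, by
    have hn : (0 : ℤ) < n := by exact_mod_cast Nat.pos_of_ne_zero (NeZero.ne n)
    have h1 := Int.emod_nonneg i hn.ne'
    have h2 := Int.emod_lt_of_pos i hn
    omega⟩

/-- Weakly decreasing integer sequences `μ_1 ≥ ⋯ ≥ μ_d`. -/
def os (d : ℕ) : Set (Fin d → ℤ) := {μ | Antitone μ}

/-- The sequences `n - 1 ≥ μ_1 ≥ ⋯ ≥ μ_d ≥ 0` with `μ_1 - μ_d + 1 ≤ ℓ_{μ_1}`. -/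
def osLin (d : ℕ) [NeZero d] (ℓ : Fin n → ℕ) : Set (Fin d → ℤ) :=
  {μ | μ ∈ os d ∧ μ 0 ≤ n - 1 ∧ 0 ≤ μ ⊤ ∧ μ 0 - μ ⊤ + 1 ≤ periodicExt ℓ (μ 0)}

/-- The sequences `μ_1 ≥ ⋯ ≥ μ_d` with `μ_1 - μ_d + 1 ≤ ℓ_{μ_1}`, `ℓ` extended periodically. -/
def osCyc (d : ℕ) [NeZero d] (ℓ : Fin n → ℕ) : Set (Fin d → ℤ) :=
  {μ | μ ∈ os d ∧ μ 0 - μ ⊤ + 1 ≤ periodicExt ℓ (μ 0)}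

variable (k : Type u) [Field k] (d : ℕ) [NeZero d]

/-- The higher Nakayama algebra `A_ℓ^{(d)}` of type `𝔸_n`. (Intervals of `ℤ^d` with end
points in the box `[0, n - 1]^d` stay in the box, so one may divide out the vertices outside
the box instead of passing to a full subcategory.) -/
abbrev linAlgebra (ℓ : Fin n → ℕ) : Type u :=
  QuotientAlgebra k d 0 (osLin d ℓ) (periodicExt ℓ)

/-- The higher Nakayama algebra of type `𝔸̃_{n-1}`. -/
abbrev cycAlgebra (ℓ : Fin n → ℕ) : Type u :=
  QuotientAlgebra k d n (osCyc d ℓ) (periodicExt ℓ)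

theorem periodicExt_succ_le {ℓ : Fin n → ℕ} (hℓ : IsKupisch ℓ) (i : ℤ) :
    periodicExt ℓ (i + 1) ≤ periodicExt ℓ i + 1 := by
  have hn : (0 : ℤ) < n := by exact_mod_cast Nat.pos_of_ne_zero (NeZero.ne n)
  have h1 := Int.emod_nonneg i hn.ne'
  have h2 := Int.emod_lt_of_pos i hn
  refine le_trans (le_of_eq ?_) (hℓ.step ⟨(i % n).toNat, by omega⟩)
  unfold periodicExt
  congr 1
  apply Fin.ext
  rw [Fin.val_add, Fin.val_one', Nat.add_mod_mod]
  zify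
  rw [Int.toNat_of_nonneg (Int.emod_nonneg _ hn.ne'), Int.toNat_of_nonneg h1, Int.emod_add_emod]

theorem sub_periodicExt_mono {ℓ : Fin n → ℕ} (hℓ : IsKupisch ℓ) :
    Monotone fun i : ℤ => i - periodicExt ℓ i :=
  monotone_int_of_le_succ fun i => by
    have := periodicExt_succ_le hℓ i
    omega

theorem isAdmissibleInterval {ℓ : Fin n → ℕ} (hℓ : IsKupisch ℓ) (s : ℤ) (U : Set (Fin d → ℤ))
    (l : Fin (d + 1) → ℤ) (hl : l 0 - l ⊤ + 1 ≤ periodicExt ℓ (l 0))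
    (hU : Set.Icc (Fin.tail l) (Fin.init l) ⊆ U) :
    IsAdmissibleInterval k s U (periodicExt ℓ) (Fin.tail l) (Fin.init l) := by
  intro f hf x hx y hy
  by_contra h
  rcases hf with hf | ⟨hd, hf⟩
  · exact (hf x y h).2 (hU hx)
  · have h1 := hf x y h 0
    have h2 := hx.1 0
    have h3 := hy.2 0
    subst hd
    have h4 := sub_periodicExt_mono hℓ h3
    have h5 : Fin.init l 0 = l 0 := rfl
    have h6 : Fin.tail l 0 = l ⊤ := rfl
    simp only [h5, h6] at h4 h2
    omega

theorem mem_os_of_mem_interval {l : Fin (d + 1) → ℤ} {x : Fin d → ℤ}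
    (hx : x ∈ Set.Icc (Fin.tail l) (Fin.init l)) : x ∈ os d := by
  cases d with
  | zero => exact absurd rfl (NeZero.ne 0)
  | succ d =>
    refine Fin.antitone_iff_succ_le.2 fun i => ?_
    exact (hx.2 i.succ).trans (hx.1 i.castSucc)

theorem interval_bounds {ℓ : Fin n → ℕ} (hℓ : IsKupisch ℓ)
    {l : Fin (d + 1) → ℤ} (hl : l 0 - l ⊤ + 1 ≤ periodicExt ℓ (l 0)) {x : Fin d → ℤ}
    (hx : x ∈ Set.Icc (Fin.tail l) (Fin.init l)) :
    x 0 ≤ l 0 ∧ l ⊤ ≤ x ⊤ ∧ x 0 - x ⊤ + 1 ≤ periodicExt ℓ (x 0) := by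
  cases d with
  | zero => exact absurd rfl (NeZero.ne 0)
  | succ d =>
    have h1 : x 0 ≤ l 0 := hx.2 0
    have h2 : l ⊤ ≤ x ⊤ := hx.1 (Fin.last d)
    have h3 := sub_periodicExt_mono hℓ h1
    simp only at h3
    exact ⟨h1, h2, by omega⟩

variable {d}

/-- The interval module `M_λ` over `A_ℓ^{(d)}`, supported on the interval
`[(λ_2, …, λ_{d+1}), (λ_1, …, λ_d)]`. -/
def linIntervalModule {ℓ : Fin n → ℕ} (hℓ : IsKupisch ℓ) (l : osLin (d + 1) ℓ) :
    FinMod k (linAlgebra k d ℓ) :=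
  intervalModule (isAdmissibleInterval k d hℓ 0 (osLin d ℓ) l.1 l.2.2.2.2 fun x hx => by
    have h := interval_bounds d hℓ l.2.2.2.2 hx
    exact ⟨mem_os_of_mem_interval d hx, h.1.trans l.2.2.1, l.2.2.2.1.trans h.2.1, h.2.2⟩)

/-- The interval module `M_λ` over the algebra of type `𝔸̃_{n-1}`. -/
def cycIntervalModule {ℓ : Fin n → ℕ} (hℓ : IsKupisch ℓ) (l : osCyc (d + 1) ℓ) :
    FinMod k (cycAlgebra k d ℓ) :=
  intervalModule (isAdmissibleInterval k d hℓ n (osCyc d ℓ) l.1 l.2.2 fun _ hx =>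
    ⟨mem_os_of_mem_interval d hx, (interval_bounds d hℓ l.2.2 hx).2.2⟩)

variable (d)

/-- The `d`-cluster-tilting subcategory of `mod A_ℓ^{(d)}`: the additive hull of the interval
modules. -/
def linClusterTilting {ℓ : Fin n → ℕ} (hℓ : IsKupisch ℓ) :
    ObjectProperty (FinMod k (linAlgebra k d ℓ)) :=
  addHull (linIntervalModule k (d := d) hℓ)

/-- The `d`-cluster-tilting subcategory in type `𝔸̃_{n-1}`: the additive hull of the interval
modules. -/
def cycClusterTilting {ℓ : Fin n → ℕ} (hℓ : IsKupisch ℓ) :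
    ObjectProperty (FinMod k (cycAlgebra k d ℓ)) :=
  addHull (cycIntervalModule k (d := d) hℓ)

end Nakayama

end

end HigherNakayama

/-!
The Schur simple objects are the simple modules `S_i` at the constant sequences `(i, …, i)`. A Schur
simple object `X` is a summand of a single interval module `M_[a, b]`. There are interval modules
`M_[a', a]` and `M_[b, b']` in the subcategory, and the canonical maps
`M_[a', a] ⟶ M_[a, b] ⟶ M_[b, b']` remain non-zero when restricted to the summand `X`. If `a ≠ b`,
their composite through `X` vanishes, which is impossible for a Schur simple object; hence `a = b`,
and the only such interval modules are the `S_i`.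

If `ℓ_i = 1`, then `S_i` is projective. If `ℓ_i ≥ 2`, it has a projective resolution by interval
modules whose syzygies are again interval modules, and the `d`-th syzygy has simple top `S_{i-1}`.
Hence `Ext^d(S_i, S_j)` has dimension at most one, and it is non-zero exactly if `ℓ_i ≥ 2` and `S_j`
is isomorphic to `S_{i-1}`. Since arrows lower the index by one, the vertex `w` of the quiver `𝔸_n`
or `𝔸̃_{n-1}` corresponds to `S_{n-1-w}`.
-/

namespace HigherNakayama

noncomputable section

section SchurSimple

variable {C : Type v} [Category.{w} C] [Preadditive C]

theorem IsSchurSimple.eq_zero_or_eq_zero_of_comp_eq_zero {S X Y : C} (hS : IsSchurSimple S)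
    {f : X ⟶ S} {g : S ⟶ Y} (h : f ≫ g = 0) : f = 0 ∨ g = 0 := by
  refine or_iff_not_imp_right.2 fun hg => ?_
  have : Mono g := hS.2.2 g hg
  exact zero_of_comp_mono g h

theorem IsSchurSimple.isIso_of_ne_zero (k : Type u) [Field k] [Linear k C] {S : C}
    (hS : IsSchurSimple S) [Module.Finite k (S ⟶ S)] {f : S ⟶ S} (hf : f ≠ 0) : IsIso f := by
  have : Mono f := hS.2.2 f hf
  have hinj : Function.Injective (Linear.rightComp k S f) := fun _ _ h => (cancel_mono f).1 h
  obtain ⟨g, hg⟩ := LinearMap.injective_iff_surjective.1 hinj (𝟙 S)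
  have : IsSplitEpi f := ⟨⟨⟨g, hg⟩⟩⟩
  exact isIso_of_mono_of_isSplitEpi f

theorem exists_comp_ne_zero_of_retract_biproduct {J : Type} [Finite J] {F : J → C}
    [HasBiproduct F] {X : C} (hX : ¬ IsZero X) (ρ : Retract X (⨁ F)) :
    ∃ j, (ρ.i ≫ biproduct.π F j) ≫ biproduct.ι F j ≫ ρ.r ≠ 0 := by
  have := Fintype.ofFinite J
  by_contra! h
  refine hX ((IsZero.iff_id_eq_zero X).2 ?_)
  calc 𝟙 X = ρ.i ≫ (∑ j, biproduct.π F j ≫ biproduct.ι F j) ≫ ρ.r := by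
        rw [biproduct.total, Category.id_comp, ρ.retract]
    _ = ∑ j, (ρ.i ≫ biproduct.π F j) ≫ biproduct.ι F j ≫ ρ.r := by
        simp only [Preadditive.sum_comp, Preadditive.comp_sum, Category.assoc]
    _ = 0 := Finset.sum_eq_zero fun j _ => h j

end SchurSimple

section AddHull

variable {C : Type v} [Category.{w} C] [Abelian C] {ι : Type*} (F : ι → C)

theorem addHull_apply (i : ι) : addHull F (F i) := by
  have := Abelian.hasFiniteBiproducts (C := C)
  exact ⟨1, fun _ => i, ⟨⟨biproduct.ι (fun _ : Fin 1 => F i) 0,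
    biproduct.π (fun _ : Fin 1 => F i) 0, biproduct.ι_π_self _ _⟩⟩⟩

theorem exists_retract_of_isSchurSimple_addHull (k : Type u) [Field k] [Linear k C]
    [∀ X Y : C, Module.Finite k (X ⟶ Y)] {X : (addHull F).FullSubcategory}
    (hX : IsSchurSimple X) : ∃ i, Nonempty (Retract X.obj (F i)) := by
  have := Abelian.hasFiniteBiproducts (C := C)
  obtain ⟨m, σ, ⟨ρ⟩⟩ := X.property
  have hX₀ : ¬ IsZero X.obj := fun h => hX.1 ((IsZero.iff_id_eq_zero X).2 (by
    ext; exact h.eq_of_src _ _))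
  obtain ⟨j, hj⟩ := exists_comp_ne_zero_of_retract_biproduct hX₀ ρ
  have : Module.Finite k (X ⟶ X) :=
    Module.Finite.equiv (InducedCategory.homLinearEquiv (R := k) (X := X) (Y := X)).symm
  let e : X ⟶ X := (addHull F).homMk
    ((ρ.i ≫ biproduct.π (fun i => F (σ i)) j) ≫ biproduct.ι (fun i => F (σ i)) j ≫ ρ.r)
  have : IsIso e := hX.isIso_of_ne_zero k fun h => hj (congrArg InducedCategory.Hom.hom h)
  exact ⟨σ j, ⟨⟨ρ.i ≫ biproduct.π (fun i => F (σ i)) j,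
    (biproduct.ι (fun i => F (σ i)) j ≫ ρ.r) ≫ (inv e).hom, by
      rw [← Category.assoc]; exact congrArg InducedCategory.Hom.hom (IsIso.hom_inv_id e)⟩⟩⟩

end AddHull

section ExtDim

variable (k : Type u) [Field k] {C : Type v} [Category.{w} C] [Abelian C] [Linear k C]

theorem extDim_le_of_retract (d : ℕ) {X X' Y Y' : C} (ρ : Retract X X') (τ : Retract Y Y') :
    extDim k d X Y ≤ extDim k d X' Y' := by
  let _ : HasExt.{max v w} C := HasExt.standard C
  let φ : Abelian.Ext X Y d →ₗ[k] Abelian.Ext X' Y' d :=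
    ((Abelian.Ext.mk₀ τ.i).postcompOfLinear k X' (add_zero d)).comp
      ((Abelian.Ext.mk₀ ρ.r).precompOfLinear k Y (zero_add d))
  let ψ : Abelian.Ext X' Y' d →ₗ[k] Abelian.Ext X Y d :=
    ((Abelian.Ext.mk₀ τ.r).postcompOfLinear k X (add_zero d)).comp
      ((Abelian.Ext.mk₀ ρ.i).precompOfLinear k Y' (zero_add d))
  refine LinearMap.rank_le_of_injective φ (Function.LeftInverse.injective (g := ψ) fun x => ?_)
  simp only [φ, ψ, LinearMap.comp_apply, Abelian.Ext.bilinearCompOfLinear_apply_apply,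
    LinearMap.flip_apply]
  rw [Abelian.Ext.comp_assoc_of_third_deg_zero, Abelian.Ext.comp_assoc_of_third_deg_zero,
    Abelian.Ext.mk₀_comp_mk₀, τ.retract, Abelian.Ext.comp_mk₀_id,
    Abelian.Ext.mk₀_comp_mk₀_assoc, ρ.retract, Abelian.Ext.mk₀_id_comp]

theorem extDim_congr (d : ℕ) {X X' Y Y' : C} (e : X ≅ X') (f : Y ≅ Y') :
    extDim k d X Y = extDim k d X' Y' :=
  le_antisymm (extDim_le_of_retract k d (.ofIso e) (.ofIso f))
    (extDim_le_of_retract k d (.ofIso e.symm) (.ofIso f.symm))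

theorem extDim_zero (X Y : C) : extDim k 0 X Y = Cardinal.lift.{v} (Module.rank k (X ⟶ Y)) := by
  let _ : HasExt.{max v w} C := HasExt.standard C
  have h := (Abelian.Ext.linearEquiv₀ (R := k) (X := X) (Y := Y)).lift_rank_eq
  rw [Cardinal.lift_id'.{w, max v w}] at h
  exact h.trans (congrFun Cardinal.lift_umax.{w, v} _)

theorem extDim_succ_of_projective (X Y : C) [Projective X] (m : ℕ) :
    extDim k (m + 1) X Y = 0 := by
  let _ : HasExt.{max v w} C := HasExt.standard C
  have := Abelian.Ext.subsingleton_of_projective X Y m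
  exact rank_subsingleton' k _

/-- For `m = 0` the right-hand side is all of `Hom(X₁, Y)`, so the maps that extend to the
projective middle term have to vanish. -/
theorem extDim_succ_of_shortExact {S : ShortComplex C} (hS : S.ShortExact) [Projective S.X₂]
    (Y : C) (m : ℕ) (h : m = 0 → ∀ φ : S.X₂ ⟶ Y, S.f ≫ φ = 0) :
    extDim k (m + 1) S.X₃ Y = extDim k m S.X₁ Y := by
  let _ : HasExt.{max v w} C := HasExt.standard C
  refine (LinearEquiv.rank_eq (LinearEquiv.ofBijective
    (hS.extClass.precompOfLinear k Y (add_comm 1 m)) ⟨?_, fun x => ?_⟩)).symm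
  · rw [← LinearMap.ker_eq_bot, Submodule.eq_bot_iff]
    intro x hx
    obtain ⟨y, rfl⟩ := Abelian.Ext.contravariant_sequence_exact₁ hS Y x (add_comm 1 m) hx
    cases m with
    | zero =>
      obtain ⟨φ, rfl⟩ := Abelian.Ext.homEquiv₀.symm.surjective y
      rw [Abelian.Ext.homEquiv₀_symm_apply, Abelian.Ext.mk₀_comp_mk₀, h rfl,
        Abelian.Ext.mk₀_zero]
    | succ m => rw [Abelian.Ext.eq_zero_of_projective y, Abelian.Ext.comp_zero]
  · exact Abelian.Ext.contravariant_sequence_exact₃ hS Y x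
      (Abelian.Ext.eq_zero_of_projective _) (add_comm 1 m)

end ExtDim

section ExtQuiver

variable (k : Type u) {C : Type v} [Category.{w} C] [Abelian C] {d : ℕ} {M : ObjectProperty C}

/-- The vertex of the `Ext^d`-quiver represented by a Schur simple object. -/
def ExtQuiver.mk (d : ℕ) {S : M.FullSubcategory} (hS : IsSchurSimple S) : ExtQuiver k d M :=
  Quotient.mk (isIsomorphicSetoid _) ⟨S, hS⟩

theorem ExtQuiver.mk_eq_mk_iff {S T : M.FullSubcategory} {hS : IsSchurSimple S}
    {hT : IsSchurSimple T} :
    ExtQuiver.mk k d hS = ExtQuiver.mk k d hT ↔ Nonempty (S ≅ T) :=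
  Quotient.eq.trans ⟨fun ⟨e⟩ => ⟨(ObjectProperty.ι _).mapIso e⟩,
    fun ⟨e⟩ => ⟨ObjectProperty.isoMk _ e⟩⟩

theorem ExtQuiver.exists_eq_mk (x : ExtQuiver k d M) :
    ∃ (S : M.FullSubcategory) (hS : IsSchurSimple S), x = ExtQuiver.mk k d hS := by
  induction x using Quotient.inductionOn with
  | _ S => exact ⟨S.obj, S.property, rfl⟩

theorem ExtQuiver.nonempty_rep_mk_iso {S : M.FullSubcategory} (hS : IsSchurSimple S) :
    Nonempty ((ExtQuiver.mk k d hS).rep ≅ S.obj) := by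
  obtain ⟨e⟩ := Quotient.exact (Quotient.out_eq (ExtQuiver.mk k d hS))
  exact ⟨M.ι.mapIso ((ObjectProperty.ι _).mapIso e)⟩

theorem nonempty_quiverIso_of_equiv {V W : Type*} [Quiver V] [Quiver W] (E : W ≃ V)
    (h : ∀ a b, Nonempty ((E a ⟶ E b) ≃ (a ⟶ b))) : Nonempty (QuiverIso V W) := by
  have h' (x y : V) : Nonempty ((x ⟶ y) ≃ (E.symm x ⟶ E.symm y)) := by
    simpa only [Equiv.apply_symm_apply] using h (E.symm x) (E.symm y)
  exact ⟨⟨E.symm, fun x y => (h' x y).some⟩⟩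

theorem ExtQuiver.nonempty_quiverIso [Field k] [Linear k C] {W : Type*} [Quiver W]
    {S : W → M.FullSubcategory} (hS : ∀ a, IsSchurSimple (S a))
    (inj : ∀ a b, Nonempty (S a ≅ S b) → a = b)
    (surj : ∀ X : M.FullSubcategory, IsSchurSimple X → ∃ a, Nonempty (S a ≅ X))
    (arrows : ∀ a b, Nonempty ((extDim k d (S a).obj (S b).obj).out ≃ (a ⟶ b))) :
    Nonempty (QuiverIso (ExtQuiver k d M) W) := by
  have hbij : Function.Bijective fun a => ExtQuiver.mk k d (hS a) := by
    refine ⟨fun a b hab => inj a b ((mk_eq_mk_iff k).1 hab), fun x => ?_⟩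
    obtain ⟨X, hX, rfl⟩ := exists_eq_mk k x
    obtain ⟨a, e⟩ := surj X hX
    exact ⟨a, (mk_eq_mk_iff k).2 e⟩
  refine nonempty_quiverIso_of_equiv (Equiv.ofBijective _ hbij) fun a b => ?_
  obtain ⟨ea⟩ := nonempty_rep_mk_iso k (d := d) (hS a)
  obtain ⟨eb⟩ := nonempty_rep_mk_iso k (d := d) (hS b)
  obtain ⟨e⟩ := arrows a b
  exact ⟨(Equiv.cast (congrArg Quotient.out (extDim_congr k d ea eb))).trans e⟩

end ExtQuiver

section FinMod

variable {k : Type u} [Field k] {A : Type u} [Ring A] [Algebra k A]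

namespace FinMod

theorem epi_iff_surjective {X Y : FinMod k A} (f : X ⟶ Y) :
    Epi f ↔ Function.Surjective f.hom.hom := by
  have := (isFinDim k A).preservesEpimorphisms_ι_of_isNormalMonoCategory
  rw [← (isFinDim k A).ι.epi_map_iff_epi f]
  exact ModuleCat.epi_iff_surjective f.hom

theorem mono_of_injective {X Y : FinMod k A} (f : X ⟶ Y)
    (hf : Function.Injective f.hom.hom) : Mono f :=
  (isFinDim k A).ι.mono_of_mono_map ((ModuleCat.mono_iff_injective f.hom).2 hf)

theorem shortExact {S : ShortComplex (FinMod k A)} (hf : Function.Injective S.f.hom.hom)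
    (hg : Function.Surjective S.g.hom.hom)
    (h : ∀ y, S.g.hom.hom y = 0 → ∃ x, S.f.hom.hom x = y) : S.ShortExact where
  exact := by
    have : (isFinDim k A).ι.PreservesHomology :=
      { preservesKernels := fun _ _ f => (isFinDim k A).preservesKernels_ι f
        preservesCokernels := fun _ _ f => (isFinDim k A).preservesCokernels_ι f }
    rw [← ShortComplex.exact_map_iff_of_faithful S (isFinDim k A).ι,
      ShortComplex.moduleCat_exact_iff]
    exact h
  mono_f := mono_of_injective _ hf
  epi_g := (epi_iff_surjective _).2 hg

/-- Morphisms of finite dimensional modules from linear maps. -/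
abbrev ofLinearMap {X Y : FinMod k A} (f : X.obj →ₗ[A] Y.obj) : X ⟶ Y :=
  (isFinDim k A).homMk (ModuleCat.ofHom f)

end FinMod

open scoped ModuleCat in
instance (X Y : FinMod k A) : Module.Finite k (X ⟶ Y) := by
  have : Module.Finite k X.obj := X.property
  have : Module.Finite k Y.obj := Y.property
  let φ : (X ⟶ Y) →ₗ[k] (X.obj →ₗ[k] Y.obj) :=
    { toFun := fun f => f.hom.hom.restrictScalars k
      map_add' := fun _ _ => rfl
      map_smul' := fun _ _ => rfl }
  refine Module.Finite.of_injective φ fun f g h => ?_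
  ext x
  exact LinearMap.congr_fun h x

end FinMod

section Translate

variable {d : ℕ} {s : ℤ} {x y z : Fin d → ℤ}

/-- Vertices of `ℤ^d` with the same image in the orbit category of the translation by
`(s, …, s)`. -/
def IsTranslate (s : ℤ) (x y : Fin d → ℤ) : Prop :=
  ∃ t : ℤ, y = fun i => x i + t * s

theorem IsTranslate.refl (s : ℤ) (x : Fin d → ℤ) : IsTranslate s x x :=
  ⟨0, by simp⟩

theorem IsTranslate.symm (h : IsTranslate s x y) : IsTranslate s y x := by
  obtain ⟨t, rfl⟩ := h
  exact ⟨-t, funext fun i => by ring⟩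

theorem IsTranslate.trans (hxy : IsTranslate s x y) (hyz : IsTranslate s y z) :
    IsTranslate s x z := by
  obtain ⟨t, rfl⟩ := hxy
  obtain ⟨t', rfl⟩ := hyz
  exact ⟨t + t', funext fun i => by ring⟩

theorem isTranslate_add_right_iff : IsTranslate s x (fun i => y i + s) ↔ IsTranslate s x y :=
  have h : IsTranslate s y fun i => y i + s := ⟨1, by simp⟩
  ⟨fun h' => h'.trans h.symm, fun h' => h'.trans h⟩

theorem orbitAlgebra_apply_translate {k : Type u} [Field k] (f : orbitAlgebra k d s) (t : ℤ)
    (x y : Fin d → ℤ) : f.1 (fun i => x i + t * s) (fun i => y i + t * s) = f.1 x y := by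
  have hf : ∀ x y : Fin d → ℤ, f.1 (fun i => x i + s) (fun i => y i + s) = f.1 x y := f.2
  induction t using Int.induction_on with
  | zero => simp
  | succ t ih =>
    rw [← ih, ← hf (fun i => x i + t * s)]
    congr! 2 <;> ring
  | pred t ih =>
    rw [← ih, ← hf (fun i => x i + (-t - 1) * s)]
    congr! 2 <;> ring

end Translate

open scoped Classical in
/-- The element of the orbit algebra with value `c u` on the morphism `u ⟶ b`, and zero on the
morphisms whose target is not a translate of `b`. -/
def column {k : Type u} [Field k] {d : ℕ} (s : ℤ) (b : Fin d → ℤ) (c : (Fin d → ℤ) → k) :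
    orbitAlgebra k d s where
  val :=
    { toFun := fun u w => if IsTranslate s b w ∧ u ≤ w then c (fun i => u i + b i - w i) else 0
      eq_zero_of_not_le' := fun u w h => if_neg fun h' => h h'.2 }
  property := by
    intro x y
    have hle : ((fun i => x i + s) ≤ fun i => y i + s) ↔ x ≤ y := by
      simp [Pi.le_def]
    have hc : (fun i => x i + s + b i - (y i + s)) = fun i => x i + b i - y i :=
      funext fun i => by ring
    change (if _ then _ else _) = (if _ then _ else _)
    simp only [isTranslate_add_right_iff, hle, hc]

section Column

variable {k : Type u} [Field k] {d : ℕ} {s : ℤ} {b : Fin d → ℤ}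

theorem column_apply_self (c : (Fin d → ℤ) → k) {u : Fin d → ℤ} (hu : u ≤ b) :
    (column s b c).1 u b = c u := by
  classical
  change (if _ then _ else _) = _
  rw [if_pos ⟨.refl s b, hu⟩]
  congr 1
  ext i
  ring

theorem exists_of_column_apply_ne_zero {c : (Fin d → ℤ) → k} {u w : Fin d → ℤ}
    (h : (column s b c).1 u w ≠ 0) :
    ∃ t : ℤ, (w = fun i => b i + t * s) ∧ c (fun i => u i - t * s) ≠ 0 := by
  classical
  change (if _ then _ else _) ≠ (0 : k) at h
  rw [ite_ne_right_iff] at h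
  obtain ⟨⟨⟨t, rfl⟩, _⟩, h⟩ := h
  refine ⟨t, rfl, ?_⟩
  convert h using 3
  ring

theorem isTranslate_of_column_apply_ne_zero {c : (Fin d → ℤ) → k} {u w : Fin d → ℤ}
    (h : (column s b c).1 u w ≠ 0) : IsTranslate s b w :=
  let ⟨t, ht, _⟩ := exists_of_column_apply_ne_zero h
  ⟨t, ht⟩

theorem eq_column (f : orbitAlgebra k d s) (c : (Fin d → ℤ) → k)
    (hf : ∀ u w, f.1 u w ≠ 0 → IsTranslate s b w) (hc : ∀ u, u ≤ b → f.1 u b = c u) :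
    f = column s b c := by
  apply Subtype.ext
  ext u w huw
  by_cases hw : IsTranslate s b w
  · obtain ⟨t, rfl⟩ := hw
    have hu : u = fun i => (u i - t * s) + t * s := by ext i; ring
    have hub : (fun i => u i - t * s) ≤ b := fun i => by linarith [huw i]
    rw [hu, orbitAlgebra_apply_translate, orbitAlgebra_apply_translate (column s b c),
      column_apply_self _ hub, hc _ hub]
  · rw [not_not.1 fun h => hw (hf u w h),
      not_not.1 fun h => hw (isTranslate_of_column_apply_ne_zero h)]

theorem column_congr {c c' : (Fin d → ℤ) → k} (h : ∀ u, u ≤ b → c u = c' u) :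
    column s b c = column s b c' :=
  eq_column _ _ (fun _ _ => isTranslate_of_column_apply_ne_zero) fun u hu => by
    rw [column_apply_self _ hu, h u hu]

theorem column_zero : column s b (0 : (Fin d → ℤ) → k) = 0 :=
  (eq_column 0 0 (fun _ _ h => absurd rfl h) fun _ _ => rfl).symm

theorem column_add (c c' : (Fin d → ℤ) → k) :
    column s b (c + c') = column s b c + column s b c' := by
  refine (eq_column _ _ (fun u w huw => ?_) fun u hu => ?_).symm
  · change (column s b c).1 u w + (column s b c').1 u w ≠ 0 at huw
    by_cases h : (column s b c).1 u w = 0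
    · rw [h, zero_add] at huw
      exact isTranslate_of_column_apply_ne_zero huw
    · exact isTranslate_of_column_apply_ne_zero h
  · change (column s b c).1 u b + (column s b c').1 u b = _
    rw [column_apply_self _ hu, column_apply_self _ hu, Pi.add_apply]

theorem mul_column (f : orbitAlgebra k d s) (c : (Fin d → ℤ) → k) :
    f * column s b c = column s b fun u => ∑ x ∈ Finset.Icc u b, f.1 u x * c x := by
  refine eq_column _ _ (fun u w huw => ?_) fun u _ => ?_
  · change (f.1 * (column s b c).1) u w ≠ 0 at huw
    rw [IncidenceAlgebra.mul_apply] at huw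
    obtain ⟨x, _, hx⟩ := Finset.exists_ne_zero_of_sum_ne_zero huw
    exact isTranslate_of_column_apply_ne_zero (right_ne_zero_of_mul hx)
  · change (f.1 * (column s b c).1) u b = _
    rw [IncidenceAlgebra.mul_apply]
    refine Finset.sum_congr rfl fun x hx => ?_
    rw [column_apply_self _ (Finset.mem_Icc.1 hx).2]

/-- The morphism `x ⟶ b` as an element of the orbit algebra. -/
def morphism (k : Type u) [Field k] {d : ℕ} (s : ℤ) (x b : Fin d → ℤ) : orbitAlgebra k d s :=
  column s b (Pi.single x 1)

theorem morphism_apply_self {x : Fin d → ℤ} (h : x ≤ b) : (morphism k s x b).1 x b = 1 := by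
  rw [morphism, column_apply_self _ h, Pi.single_eq_same]

theorem exists_of_morphism_apply_ne_zero {x u w : Fin d → ℤ}
    (h : (morphism k s x b).1 u w ≠ 0) :
    ∃ t : ℤ, (u = fun i => x i + t * s) ∧ w = fun i => b i + t * s := by
  obtain ⟨t, ht, h⟩ := exists_of_column_apply_ne_zero h
  have hx : (fun i => u i - t * s) = x := not_not.1 fun hx => h (Pi.single_eq_of_ne hx _)
  exact ⟨t, funext fun i => by rw [← hx]; ring, ht⟩

theorem column_mul_morphism {w : Fin d → ℤ} (hw : w ≤ b) {c : (Fin d → ℤ) → k}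
    (hc : ∀ u, u ≤ b → c u ≠ 0 → u ≤ w) :
    column s w c * morphism k s w b = column s b c := by
  rw [morphism, mul_column]
  refine column_congr fun u hu => ?_
  by_cases huw : u ≤ w
  · rw [Finset.sum_eq_single w, column_apply_self _ huw, Pi.single_eq_same, mul_one]
    · intro x _ hx
      rw [Pi.single_eq_of_ne hx, mul_zero]
    · exact fun h => absurd (Finset.mem_Icc.2 ⟨huw, hw⟩) h
  · rw [not_not.1 fun h => huw (hc u hu h)]
    refine Finset.sum_eq_zero fun x _ => ?_
    by_cases hx : x = w
    · rw [hx, IncidenceAlgebra.apply_eq_zero_of_not_le huw, zero_mul]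
    · rw [Pi.single_eq_of_ne hx, mul_zero]

theorem morphism_self_mul_morphism {w : Fin d → ℤ} (hw : w ≤ b) :
    morphism k s w w * morphism k s w b = morphism k s w b :=
  column_mul_morphism hw fun _ _ hu => (not_not.1 fun hne => hu (Pi.single_eq_of_ne hne _)).le

end Column

section Quotient

variable {k : Type u} [Field k] {d : ℕ} {s : ℤ} {U : Set (Fin d → ℤ)} {ℓ : ℤ → ℕ}
  {a b : Fin d → ℤ}

/-- The class of an element of the orbit algebra. -/
def toQuotient (k : Type u) [Field k] {d : ℕ} (s : ℤ) (U : Set (Fin d → ℤ)) (ℓ : ℤ → ℕ) :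
    orbitAlgebra k d s →+* QuotientAlgebra k d s U ℓ :=
  (TwoSidedIdeal.span (relations k d s U ℓ)).ringCon.mk'

theorem toQuotient_surjective :
    Function.Surjective (toQuotient k s U ℓ : orbitAlgebra k d s →+* QuotientAlgebra k d s U ℓ) :=
  RingCon.mk'_surjective _

theorem toQuotient_eq_zero_of_mem {f : orbitAlgebra k d s} (hf : f ∈ relations k d s U ℓ) :
    toQuotient k s U ℓ f = 0 := by
  have h : f ∈ TwoSidedIdeal.span (relations k d s U ℓ) := TwoSidedIdeal.subset_span hf
  exact (RingCon.eq (TwoSidedIdeal.span (relations k d s U ℓ)).ringCon).2 h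

theorem toQuotient_morphism_eq_zero_of_notMem
    (hU : ∀ ⦃x y : Fin d → ℤ⦄, IsTranslate s x y → x ∈ U → y ∈ U) {w : Fin d → ℤ} (hwb : w ≤ b)
    (hw : w ∉ U) : toQuotient k s U ℓ (morphism k s w b) = 0 := by
  have h : morphism k s w w ∈ relations k d s U ℓ := by
    refine Or.inl fun x y hxy => ?_
    obtain ⟨t, rfl, rfl⟩ := exists_of_morphism_apply_ne_zero hxy
    exact ⟨rfl, fun ht => hw (hU (IsTranslate.symm ⟨t, rfl⟩) ht)⟩
  rw [← morphism_self_mul_morphism hwb, RingHom.map_mul, toQuotient_eq_zero_of_mem h, zero_mul]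

theorem toQuotient_morphism_eq_zero_of_path (hd : d = 1)
    (hℓ : ∀ i t : ℤ, ℓ (i + t * s) = ℓ i) {w : Fin d → ℤ} (h : ∀ i, w i = b i - ℓ (b i)) :
    toQuotient k s U ℓ (morphism k s w b) = 0 := by
  refine toQuotient_eq_zero_of_mem (Or.inr ⟨hd, fun x y hxy i => ?_⟩)
  obtain ⟨t, rfl, rfl⟩ := exists_of_morphism_apply_ne_zero hxy
  simp only [hℓ, h i]
  ring

/-- The interval `[a, b]` carries the projective at `b`: every morphism to `b` from a vertex
outside the interval vanishes in the quotient algebra. Such a morphism factors through one of the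
maximal vertices below `b` and outside the interval, so only these are mentioned. -/
structure IsProjectiveInterval (k : Type u) [Field k] {d : ℕ} (s : ℤ) (U : Set (Fin d → ℤ))
    (ℓ : ℤ → ℕ) (a b : Fin d → ℤ) : Prop where
  le : a ≤ b
  toQuotient_morphism_eq_zero : ∀ i,
    toQuotient k s U ℓ (morphism k s (Function.update b i (a i - 1)) b) = 0

namespace IsProjectiveInterval

variable (hP : IsProjectiveInterval k s U ℓ a b)

include hP

theorem toQuotient_column_eq_zero_of_lt (i : Fin d) {c : (Fin d → ℤ) → k}
    (hc : ∀ u, u ≤ b → c u ≠ 0 → u i < a i) : toQuotient k s U ℓ (column s b c) = 0 := by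
  rw [← column_mul_morphism (w := Function.update b i (a i - 1)), RingHom.map_mul,
    hP.toQuotient_morphism_eq_zero, mul_zero]
  · exact update_le_self_iff.2 (by linarith [hP.le i])
  · exact fun u hub hu => le_update_iff.2 ⟨Int.le_sub_one_of_lt (hc u hub hu), fun j _ => hub j⟩

theorem toQuotient_column_eq_zero_of_exists_lt (T : Finset (Fin d)) {c : (Fin d → ℤ) → k}
    (hc : ∀ u, u ≤ b → c u ≠ 0 → ∃ i ∈ T, u i < a i) :
    toQuotient k s U ℓ (column s b c) = 0 := by
  classical
  induction T using Finset.induction generalizing c with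
  | empty =>
    have h : column s b c = column s b 0 := column_congr fun u hu => by
      by_contra hcu
      simpa using hc u hu hcu
    rw [h, column_zero, RingHom.map_zero]
  | insert i T _ ih =>
    have hsplit : c = (fun u => if u i < a i then c u else 0) +
        fun u => if u i < a i then 0 else c u := by
      ext u
      by_cases h : u i < a i <;> simp [h]
    rw [hsplit, column_add, RingHom.map_add,
      hP.toQuotient_column_eq_zero_of_lt i fun u _ hu => (ite_ne_right_iff.1 hu).1, zero_add]
    refine ih fun u hub hu => ?_
    obtain ⟨hai, hcu⟩ := ite_ne_left_iff.1 hu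
    obtain ⟨j, hj, hlt⟩ := hc u hub (Ne.symm hcu)
    rcases Finset.mem_insert.1 hj with rfl | hj
    · exact absurd hlt hai
    · exact ⟨j, hj, hlt⟩

theorem toQuotient_column_congr {c c' : (Fin d → ℤ) → k} (hc : ∀ u ∈ Set.Icc a b, c u = c' u) :
    toQuotient k s U ℓ (column s b c) = toQuotient k s U ℓ (column s b c') := by
  rw [← add_sub_cancel c' c, column_add, RingHom.map_add, add_eq_left]
  refine hP.toQuotient_column_eq_zero_of_exists_lt Finset.univ fun u hub hu => ?_
  by_contra! hau
  exact hu (sub_eq_zero.2 (hc u ⟨fun i => hau i (Finset.mem_univ i), hub⟩))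

end IsProjectiveInterval

end Quotient

section IntervalModules

variable {k : Type u} [Field k] {d : ℕ} {s : ℤ} {U : Set (Fin d → ℤ)} {ℓ : ℤ → ℕ}
  {a b : Fin d → ℤ}

open scoped ModuleCat

/-- The elements of an interval module are the functions on the interval. -/
def toFunction (h : IsAdmissibleInterval k s U ℓ a b) :
    (intervalModule h).obj ≃ₗ[k] (Set.Icc a b → k) :=
  { AddEquiv.refl (IntervalSpace k a b) with
    map_smul' := fun c v => by
      let w : IntervalSpace k a b := v
      change intervalAction h (algebraMap k _ c) w = c • w
      rw [AlgHom.commutes]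
      rfl }

/-- The values of an element of an interval module at all vertices of `ℤ^d`, zero outside the
interval. -/
def value (h : IsAdmissibleInterval k s U ℓ a b) :
    (intervalModule h).obj →ₗ[k] ((Fin d → ℤ) → k) :=
  Function.ExtendByZero.linearMap k Subtype.val ∘ₗ (toFunction h).toLinearMap

/-- The element of an interval module with prescribed values on the interval. -/
def ofFunction (h : IsAdmissibleInterval k s U ℓ a b) :
    ((Fin d → ℤ) → k) →ₗ[k] (intervalModule h).obj :=
  (toFunction h).symm.toLinearMap ∘ₗ LinearMap.funLeft k k Subtype.val

theorem value_coe (h : IsAdmissibleInterval k s U ℓ a b) (v : (intervalModule h).obj)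
    (x : Set.Icc a b) : value h v x = toFunction h v x :=
  Subtype.val_injective.extend_apply _ _ _

theorem value_of_notMem (h : IsAdmissibleInterval k s U ℓ a b) (v : (intervalModule h).obj)
    {u : Fin d → ℤ} (hu : u ∉ Set.Icc a b) : value h v u = 0 :=
  Function.extend_apply' _ _ _ fun ⟨x, hx⟩ => hu (hx ▸ x.2)

theorem mem_of_value_ne_zero {h : IsAdmissibleInterval k s U ℓ a b} {v : (intervalModule h).obj}
    {u : Fin d → ℤ} (hu : value h v u ≠ 0) : u ∈ Set.Icc a b :=
  by_contra fun hu' => hu (value_of_notMem h v hu')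

theorem value_ofFunction (h : IsAdmissibleInterval k s U ℓ a b) (c : (Fin d → ℤ) → k)
    {u : Fin d → ℤ} (hu : u ∈ Set.Icc a b) : value h (ofFunction h c) u = c u :=
  value_coe h _ ⟨u, hu⟩

theorem value_ext {h : IsAdmissibleInterval k s U ℓ a b} {v w : (intervalModule h).obj}
    (H : ∀ u ∈ Set.Icc a b, value h v u = value h w u) : v = w :=
  (toFunction h).injective <| funext fun x => by
    rw [← value_coe, ← value_coe, H x x.2]

theorem exists_value_ne_zero {h : IsAdmissibleInterval k s U ℓ a b} {v : (intervalModule h).obj}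
    (hv : v ≠ 0) : ∃ u, value h v u ≠ 0 := by
  by_contra! H
  exact hv (value_ext fun u _ => by rw [H, map_zero, Pi.zero_apply])

theorem ofFunction_value (h : IsAdmissibleInterval k s U ℓ a b) (v : (intervalModule h).obj) :
    ofFunction h (value h v) = v :=
  value_ext fun _ hu => value_ofFunction h _ hu

theorem value_smul (h : IsAdmissibleInterval k s U ℓ a b) (f : orbitAlgebra k d s)
    (v : (intervalModule h).obj) {x : Fin d → ℤ} (hx : x ∈ Set.Icc a b) :
    value h (toQuotient k s U ℓ f • v) x = ∑ y ∈ Finset.Icc a b, f.1 x y * value h v y := by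
  calc value h (toQuotient k s U ℓ f • v) x
      = ∑ y : Set.Icc a b, f.1 x y * toFunction h v y := value_coe h _ ⟨x, hx⟩
    _ = ∑ y : Set.Icc a b, f.1 x y * value h v y := by simp only [value_coe]
    _ = ∑ y ∈ Finset.Icc a b, f.1 x y * value h v y :=
      (Finset.sum_subtype _ (fun _ => Finset.mem_Icc) fun y => f.1 x y * value h v y).symm

/-- The basis vector of an interval module at the vertex `x`; zero if `x` is not in the
interval. -/
def basisVector (h : IsAdmissibleInterval k s U ℓ a b) (x : Fin d → ℤ) : (intervalModule h).obj :=
  ofFunction h (Pi.single x 1)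

theorem value_basisVector (h : IsAdmissibleInterval k s U ℓ a b) {x : Fin d → ℤ}
    (hx : x ∈ Set.Icc a b) : value h (basisVector h x) = Pi.single x 1 := by
  funext u
  by_cases hu : u ∈ Set.Icc a b
  · exact value_ofFunction h _ hu
  · rw [value_of_notMem h _ hu, Pi.single_eq_of_ne (ne_of_mem_of_not_mem hx hu).symm]

theorem column_smul_basisVector (h : IsAdmissibleInterval k s U ℓ a b) (hab : a ≤ b)
    (c : (Fin d → ℤ) → k) :
    toQuotient k s U ℓ (column s b c) • basisVector h b = ofFunction h c := by
  have hb : b ∈ Set.Icc a b := ⟨hab, le_rfl⟩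
  refine value_ext fun u hu => ?_
  rw [value_smul h _ _ hu, value_basisVector h hb, value_ofFunction h _ hu,
    Finset.sum_eq_single b, column_apply_self _ hu.2, Pi.single_eq_same, mul_one]
  · intro y _ hy
    rw [Pi.single_eq_of_ne hy, mul_zero]
  · exact fun hb' => absurd (Finset.mem_Icc.2 hb) hb'

theorem morphism_smul_basisVector (h : IsAdmissibleInterval k s U ℓ a b) (hab : a ≤ b)
    (x : Fin d → ℤ) :
    toQuotient k s U ℓ (morphism k s x b) • basisVector h b = basisVector h x :=
  column_smul_basisVector h hab _

theorem hom_ext_of_basisVector (h : IsAdmissibleInterval k s U ℓ a b) (hab : a ≤ b)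
    {X : FinMod k (QuotientAlgebra k d s U ℓ)} {f g : intervalModule h ⟶ X}
    (hfg : f.hom.hom (basisVector h b) = g.hom.hom (basisVector h b)) : f = g := by
  ext v
  rw [← ofFunction_value h v, ← column_smul_basisVector h hab, map_smul, map_smul, hfg]

section IntervalMap

variable {a' b' : Fin d → ℤ}

theorem ofFunction_value_smul (h : IsAdmissibleInterval k s U ℓ a b)
    (h' : IsAdmissibleInterval k s U ℓ a' b') (ha : a ≤ a') (hb : b ≤ b')
    (f : orbitAlgebra k d s) (v : (intervalModule h).obj) :
    ofFunction h' (value h (toQuotient k s U ℓ f • v)) =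
      toQuotient k s U ℓ f • ofFunction h' (value h v) := by
  refine value_ext fun x hx => ?_
  have hsum : ∑ y ∈ Finset.Icc a' b', f.1 x y * value h' (ofFunction h' (value h v)) y =
      ∑ y ∈ Finset.Icc a' b', f.1 x y * value h v y :=
    Finset.sum_congr rfl fun y hy => by rw [value_ofFunction h' _ (Finset.mem_Icc.1 hy)]
  rw [value_ofFunction h' _ hx, value_smul h' _ _ hx, hsum]
  by_cases hxb : x ≤ b
  · rw [value_smul h _ _ ⟨ha.trans hx.1, hxb⟩]
    refine Finset.sum_congr_of_eq_on_inter ?_ ?_ fun _ _ _ => rfl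
    · intro y hy hy'
      rw [IncidenceAlgebra.apply_eq_zero_of_not_le, zero_mul]
      exact fun hxy => hy' (Finset.mem_Icc.2
        ⟨hx.1.trans hxy, (Finset.mem_Icc.1 hy).2.trans hb⟩)
    · intro y _ hy
      rw [value_of_notMem h _ (mt Finset.mem_Icc.2 hy), mul_zero]
  · rw [value_of_notMem h _ fun hx' => hxb hx'.2]
    refine (Finset.sum_eq_zero fun y _ => ?_).symm
    by_cases hyb : y ≤ b
    · rw [IncidenceAlgebra.apply_eq_zero_of_not_le fun hxy => hxb (hxy.trans hyb), zero_mul]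
    · rw [value_of_notMem h _ fun hy' => hyb hy'.2, mul_zero]

/-- The canonical map between interval modules: restriction to the intersection of the intervals,
followed by extension by zero. -/
def intervalMap (h : IsAdmissibleInterval k s U ℓ a b) (h' : IsAdmissibleInterval k s U ℓ a' b')
    (ha : a ≤ a') (hb : b ≤ b') : intervalModule h ⟶ intervalModule h' :=
  FinMod.ofLinearMap
    { toFun := fun v => ofFunction h' (value h v)
      map_add' := fun v w => by rw [map_add, map_add]
      map_smul' := fun q v => by
        obtain ⟨f, rfl⟩ := toQuotient_surjective q
        exact ofFunction_value_smul h h' ha hb f v }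

variable (h : IsAdmissibleInterval k s U ℓ a b) (h' : IsAdmissibleInterval k s U ℓ a' b')
  (ha : a ≤ a') (hb : b ≤ b')

theorem intervalMap_apply (v : (intervalModule h).obj) :
    (intervalMap h h' ha hb).hom.hom v = ofFunction h' (value h v) :=
  rfl

theorem value_intervalMap (v : (intervalModule h).obj) {u : Fin d → ℤ} (hu : u ∈ Set.Icc a' b') :
    value h' ((intervalMap h h' ha hb).hom.hom v) u = value h v u := by
  rw [intervalMap_apply, value_ofFunction h' _ hu]

theorem intervalMap_basisVector {x : Fin d → ℤ} (hx : x ∈ Set.Icc a b) :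
    (intervalMap h h' ha hb).hom.hom (basisVector h x) = basisVector h' x := by
  rw [intervalMap_apply, value_basisVector h hx, basisVector]

include ha hb in
theorem intervalMap_shortExact (hP : IsAdmissibleInterval k s U ℓ a b')
    (hsplit : ∀ x ∈ Set.Icc a b', x ≤ b ↔ ¬ a' ≤ x) :
    ∃ w, (ShortComplex.mk (intervalMap h hP le_rfl hb)
      (intervalMap hP h' ha le_rfl) w).ShortExact := by
  have w : intervalMap h hP le_rfl hb ≫ intervalMap hP h' ha le_rfl = 0 := by
    ext v
    refine value_ext (h := h') fun u hu => ?_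
    have hu' : u ∈ Set.Icc a b' := ⟨ha.trans hu.1, hu.2⟩
    refine (value_intervalMap hP h' ha le_rfl _ hu).trans ?_
    refine (value_intervalMap h hP le_rfl hb v hu').trans ?_
    rw [value_of_notMem h _ fun hx => (hsplit u hu').1 hx.2 hu.1]
    exact (congrFun (map_zero (value h')) u).symm
  refine ⟨w, FinMod.shortExact ?_ ?_ ?_⟩
  · intro v v' hv
    refine value_ext (h := h) fun u hu => ?_
    have hu' : u ∈ Set.Icc a b' := ⟨hu.1, hu.2.trans hb⟩
    rw [← value_intervalMap h hP le_rfl hb v hu', ← value_intervalMap h hP le_rfl hb v' hu']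
    exact congrFun (congrArg (value hP) hv) u
  · intro v
    refine ⟨ofFunction hP (value h' v), value_ext (h := h') fun u hu => ?_⟩
    exact (value_intervalMap hP h' ha le_rfl _ hu).trans
      (value_ofFunction hP _ ⟨ha.trans hu.1, hu.2⟩)
  · intro v hv
    refine ⟨ofFunction h (value hP v), value_ext (h := hP) fun u hu => ?_⟩
    refine (value_intervalMap h hP le_rfl hb _ hu).trans ?_
    by_cases hub : u ≤ b
    · exact value_ofFunction h _ ⟨hu.1, hub⟩
    · have hau : a' ≤ u := not_not.1 (mt (hsplit u hu).2 hub)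
      have hvu := value_intervalMap hP h' ha le_rfl v ⟨hau, hu.2⟩
      rw [value_of_notMem h _ fun hx => hub hx.2, ← hvu]
      exact ((congrFun (congrArg (value h') hv) u).trans
        (congrFun (map_zero (value h')) u)).symm

end IntervalMap

namespace IsProjectiveInterval

variable (hP : IsProjectiveInterval k s U ℓ a b) (h : IsAdmissibleInterval k s U ℓ a b)

include hP

theorem toQuotient_column_value_smul (f : orbitAlgebra k d s) (v : (intervalModule h).obj) :
    toQuotient k s U ℓ (column s b (value h (toQuotient k s U ℓ f • v))) =
      toQuotient k s U ℓ f * toQuotient k s U ℓ (column s b (value h v)) := by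
  rw [← RingHom.map_mul, mul_column]
  refine hP.toQuotient_column_congr fun u hu => ?_
  rw [value_smul h _ _ hu]
  symm
  refine Finset.sum_subset (Finset.Icc_subset_Icc_left hu.1) fun y hy hy' => ?_
  rw [IncidenceAlgebra.apply_eq_zero_of_not_le, zero_mul]
  exact fun huy => hy' (Finset.mem_Icc.2 ⟨huy, (Finset.mem_Icc.1 hy).2⟩)

/-- The morphism from the interval module to `X` given by an element of `X`; only the image of the
element under the idempotent at `b` matters. -/
def lift {X : FinMod k (QuotientAlgebra k d s U ℓ)} (m : X.obj) : intervalModule h ⟶ X :=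
  FinMod.ofLinearMap
    { toFun := fun v => toQuotient k s U ℓ (column s b (value h v)) • m
      map_add' := fun v w => by rw [map_add, column_add, RingHom.map_add, add_smul]
      map_smul' := fun q v => by
        obtain ⟨f, rfl⟩ := toQuotient_surjective q
        rw [hP.toQuotient_column_value_smul h, mul_smul, RingHom.id_apply] }

theorem lift_apply {X : FinMod k (QuotientAlgebra k d s U ℓ)} (m : X.obj)
    (v : (intervalModule h).obj) :
    (hP.lift h m).hom.hom v = toQuotient k s U ℓ (column s b (value h v)) • m :=
  rfl

theorem projective : Projective (intervalModule h) where
  factors {E X} f e _ := by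
    obtain ⟨m, hm⟩ := (FinMod.epi_iff_surjective e).1 ‹_› (f.hom.hom (basisVector h b))
    refine ⟨hP.lift h m, hom_ext_of_basisVector h hP.le ?_⟩
    calc e.hom.hom ((hP.lift h m).hom.hom (basisVector h b))
        = f.hom.hom (toQuotient k s U ℓ (column s b (value h (basisVector h b))) •
            basisVector h b) := by rw [lift_apply, map_smul, hm, ← map_smul]
      _ = f.hom.hom (basisVector h b) := by
        rw [column_smul_basisVector h hP.le, ofFunction_value]

end IsProjectiveInterval

end IntervalModules

section OnePointModules

variable {k : Type u} [Field k] {d : ℕ} {s : ℤ} {U : Set (Fin d → ℤ)} {ℓ : ℤ → ℕ}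
  {a b c : Fin d → ℤ}

open scoped ModuleCat

theorem onePoint_ext {h : IsAdmissibleInterval k s U ℓ a a} {v w : (intervalModule h).obj}
    (H : value h v a = value h w a) : v = w :=
  value_ext fun _ hu => by rwa [le_antisymm hu.2 hu.1]

theorem value_smul_onePoint (h : IsAdmissibleInterval k s U ℓ a a) (f : orbitAlgebra k d s)
    (v : (intervalModule h).obj) :
    value h (toQuotient k s U ℓ f • v) a = f.1 a a * value h v a := by
  rw [value_smul h _ _ ⟨le_rfl, le_rfl⟩, Finset.Icc_self, Finset.sum_singleton]

theorem exists_smul_eq_onePoint {h : IsAdmissibleInterval k s U ℓ a a} {v : (intervalModule h).obj}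
    (hv : v ≠ 0) (w : (intervalModule h).obj) :
    ∃ q : QuotientAlgebra k d s U ℓ, q • v = w := by
  have hv' : value h v a ≠ 0 := fun h0 => hv (onePoint_ext (by rw [h0, map_zero, Pi.zero_apply]))
  refine ⟨toQuotient k s U ℓ (column s a fun _ => value h w a / value h v a), onePoint_ext ?_⟩
  rw [value_smul_onePoint, column_apply_self _ le_rfl, div_mul_cancel₀ _ hv']

theorem surjective_of_ne_zero_onePoint {h : IsAdmissibleInterval k s U ℓ a a}
    {X : FinMod k (QuotientAlgebra k d s U ℓ)} {f : X ⟶ intervalModule h} (hf : f ≠ 0) :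
    Function.Surjective f.hom.hom := by
  intro w
  obtain ⟨x, hx⟩ : ∃ x, f.hom.hom x ≠ 0 := by
    by_contra! hx
    exact hf (by ext x; exact hx x)
  obtain ⟨q, hq⟩ := exists_smul_eq_onePoint hx w
  exact ⟨q • x, by rw [map_smul, hq]⟩

theorem injective_of_ne_zero_onePoint {h : IsAdmissibleInterval k s U ℓ a a}
    {X : FinMod k (QuotientAlgebra k d s U ℓ)} {f : intervalModule h ⟶ X} (hf : f ≠ 0) :
    Function.Injective f.hom.hom := by
  rw [injective_iff_map_eq_zero]
  intro v hv
  by_contra hne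
  refine hf ?_
  ext w
  obtain ⟨q, rfl⟩ := exists_smul_eq_onePoint hne w
  rw [map_smul, hv, smul_zero]
  rfl

theorem not_isZero_onePoint (h : IsAdmissibleInterval k s U ℓ a a) :
    ¬ IsZero (intervalModule h) := by
  intro h0
  have hid : 𝟙 (intervalModule h) = 0 := (IsZero.iff_id_eq_zero _).1 h0
  have hbasis : basisVector h a = 0 :=
    congrArg (fun f : intervalModule h ⟶ intervalModule h => f.hom.hom (basisVector h a)) hid
  have hvalue := value_basisVector h ⟨le_rfl, le_rfl⟩
  rw [hbasis, map_zero] at hvalue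
  exact zero_ne_one ((congrFun hvalue a).trans (Pi.single_eq_same (M := fun _ => k) a 1))

theorem isSchurSimple_onePoint {P : ObjectProperty (FinMod k (QuotientAlgebra k d s U ℓ))}
    (h : IsAdmissibleInterval k s U ℓ a a) (hP : P (intervalModule h)) :
    IsSchurSimple (⟨intervalModule h, hP⟩ : P.FullSubcategory) := by
  refine ⟨fun h0 => not_isZero_onePoint h ?_, fun X f hf => ?_, fun Y f hf => ?_⟩
  · rw [IsZero.iff_id_eq_zero] at h0 ⊢
    exact congrArg InducedCategory.Hom.hom h0
  · have hf' : f.hom ≠ 0 := fun h0 => hf (by ext1; exact h0)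
    have : Epi (P.ι.map f) := (FinMod.epi_iff_surjective _).2 (surjective_of_ne_zero_onePoint hf')
    exact P.ι.epi_of_epi_map this
  · have hf' : f.hom ≠ 0 := fun h0 => hf (by ext1; exact h0)
    have : Mono (P.ι.map f) := FinMod.mono_of_injective _ (injective_of_ne_zero_onePoint hf')
    exact P.ι.mono_of_mono_map this

theorem nonempty_iso_of_retract_onePoint {X : FinMod k (QuotientAlgebra k d s U ℓ)}
    (hX : ¬ IsZero X) (h : IsAdmissibleInterval k s U ℓ a a) (ρ : Retract X (intervalModule h)) :
    Nonempty (intervalModule h ≅ X) := by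
  have hi : ρ.i ≠ 0 := fun h0 => hX ((IsZero.iff_id_eq_zero X).2 (by
    rw [← ρ.retract, h0, zero_comp]))
  have : Epi ρ.i := (FinMod.epi_iff_surjective _).2 (surjective_of_ne_zero_onePoint hi)
  have : IsIso ρ.i := isIso_of_epi_of_isSplitMono ρ.i
  exact ⟨(asIso ρ.i).symm⟩

/-- The canonical map between the modules on a vertex and on a translate of it. -/
def translateMap (h : IsAdmissibleInterval k s U ℓ a a) (h' : IsAdmissibleInterval k s U ℓ c c)
    (hac : IsTranslate s a c) : intervalModule h ⟶ intervalModule h' :=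
  FinMod.ofLinearMap
    { toFun := fun v => ofFunction h' fun _ => value h v a
      map_add' := fun v w => onePoint_ext (h := h') (by
        rw [value_ofFunction h' _ ⟨le_rfl, le_rfl⟩, map_add, map_add, Pi.add_apply, Pi.add_apply,
          value_ofFunction h' _ ⟨le_rfl, le_rfl⟩, value_ofFunction h' _ ⟨le_rfl, le_rfl⟩])
      map_smul' := fun q v => onePoint_ext (h := h') (by
        obtain ⟨f, rfl⟩ := toQuotient_surjective q
        obtain ⟨t, rfl⟩ := hac
        rw [RingHom.id_apply, value_smul_onePoint h', value_ofFunction h' _ ⟨le_rfl, le_rfl⟩,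
          value_smul_onePoint h, value_ofFunction h' _ ⟨le_rfl, le_rfl⟩,
          orbitAlgebra_apply_translate]) }

theorem value_translateMap (h : IsAdmissibleInterval k s U ℓ a a)
    (h' : IsAdmissibleInterval k s U ℓ c c) (hac : IsTranslate s a c)
    (v : (intervalModule h).obj) :
    value h' ((translateMap h h' hac).hom.hom v) c = value h v a :=
  value_ofFunction h' (fun _ => value h v a) ⟨le_rfl, le_rfl⟩

theorem nonempty_iso_onePoint (h : IsAdmissibleInterval k s U ℓ a a)
    (h' : IsAdmissibleInterval k s U ℓ c c) (hac : IsTranslate s a c) :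
    Nonempty (intervalModule h ≅ intervalModule h') := by
  refine ⟨⟨translateMap h h' hac, translateMap h' h hac.symm, ?_, ?_⟩⟩
  · ext v
    exact onePoint_ext (h := h) ((value_translateMap h' h hac.symm _).trans
      (value_translateMap h h' hac _))
  · ext v
    exact onePoint_ext (h := h') ((value_translateMap h h' hac _).trans
      (value_translateMap h' h hac.symm _))

theorem hom_onePoint_eq_zero (h : IsAdmissibleInterval k s U ℓ a b) (hab : a ≤ b)
    (hc : IsAdmissibleInterval k s U ℓ c c) (hbc : ¬ IsTranslate s b c)
    (φ : intervalModule h ⟶ intervalModule hc) : φ = 0 := by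
  refine hom_ext_of_basisVector h hab (onePoint_ext (h := hc) ?_)
  have hcc : (morphism k s b b).1 c c = 0 :=
    not_not.1 fun hne => hbc (isTranslate_of_column_apply_ne_zero hne)
  rw [← morphism_smul_basisVector h hab b, map_smul, value_smul_onePoint, hcc, zero_mul]
  exact (congrFun (map_zero (value hc)) c).symm

theorem isTranslate_of_iso_onePoint (h : IsAdmissibleInterval k s U ℓ a a)
    (h' : IsAdmissibleInterval k s U ℓ c c) (e : intervalModule h ≅ intervalModule h') :
    IsTranslate s a c := by
  by_contra hac
  refine not_isZero_onePoint h ((IsZero.iff_id_eq_zero _).2 ?_)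
  rw [← e.hom_inv_id, hom_onePoint_eq_zero h le_rfl h' hac e.hom, zero_comp]

theorem intervalMap_comp_hom_onePoint_eq_zero {b' : Fin d → ℤ}
    (h : IsAdmissibleInterval k s U ℓ a b) (h' : IsAdmissibleInterval k s U ℓ a b') (hab : a ≤ b)
    (hb : b < b') (hc : IsAdmissibleInterval k s U ℓ c c)
    (φ : intervalModule h' ⟶ intervalModule hc) : intervalMap h h' le_rfl hb.le ≫ φ = 0 := by
  refine hom_ext_of_basisVector h hab (onePoint_ext (h := hc) ?_)
  have hmorphism : (morphism k s b b').1 c c = 0 := by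
    by_contra hne
    obtain ⟨t, hbt, hbt'⟩ := exists_of_morphism_apply_ne_zero hne
    refine hb.ne (funext fun i => ?_)
    linarith [congrFun hbt i, congrFun hbt' i]
  calc value hc (φ.hom.hom ((intervalMap h h' le_rfl hb.le).hom.hom (basisVector h b))) c
      = value hc (toQuotient k s U ℓ (morphism k s b b') • φ.hom.hom (basisVector h' b')) c := by
        rw [intervalMap_basisVector h h' le_rfl hb.le ⟨hab, le_rfl⟩,
          ← morphism_smul_basisVector h' (hab.trans hb.le), map_smul]
    _ = 0 := by rw [value_smul_onePoint, hmorphism, zero_mul]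
    _ = _ := (congrFun (map_zero (value hc)) c).symm

theorem IsAdmissibleInterval.mono {a' b' : Fin d → ℤ} (h : IsAdmissibleInterval k s U ℓ a b)
    (ha : a ≤ a') (hb : b' ≤ b) : IsAdmissibleInterval k s U ℓ a' b' :=
  fun f hf x hx y hy => h f hf x (Set.Icc_subset_Icc ha hb hx) y (Set.Icc_subset_Icc ha hb hy)

open scoped Classical in
theorem rank_hom_onePoint (h : IsAdmissibleInterval k s U ℓ a b) (hab : a ≤ b)
    (hc : IsAdmissibleInterval k s U ℓ c c) :
    Module.rank k (intervalModule h ⟶ intervalModule hc) = if IsTranslate s b c then 1 else 0 := by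
  split_ifs with hbc
  · have hb : IsAdmissibleInterval k s U ℓ b b := h.mono hab le_rfl
    let ψ : intervalModule h ⟶ intervalModule hc :=
      intervalMap h hb hab le_rfl ≫ translateMap hb hc hbc
    have hψ : value hc (ψ.hom.hom (basisVector h b)) c = 1 := by
      refine (value_translateMap hb hc hbc _).trans ?_
      refine (value_intervalMap h hb hab le_rfl _ ⟨le_rfl, le_rfl⟩).trans ?_
      rw [value_basisVector h ⟨hab, le_rfl⟩, Pi.single_eq_same]
    refine rank_eq_one_iff.2 ⟨ψ, fun h0 => ?_,
      fun φ => ⟨value hc (φ.hom.hom (basisVector h b)) c, ?_⟩⟩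
    · rw [h0] at hψ
      exact zero_ne_one ((congrFun (map_zero (value hc)) c).symm.trans hψ)
    · refine hom_ext_of_basisVector h hab (onePoint_ext (h := hc) ?_)
      refine (congrFun (map_smul (value hc) _ (ψ.hom.hom (basisVector h b))) c).trans ?_
      rw [Pi.smul_apply, hψ, smul_eq_mul, mul_one]
  · have : Subsingleton (intervalModule h ⟶ intervalModule hc) :=
      subsingleton_of_forall_eq 0 (hom_onePoint_eq_zero h hab hc hbc)
    exact rank_subsingleton' k _

end OnePointModules

section Endomorphisms

variable {k : Type u} [Field k] {d : ℕ} {s : ℤ} {U : Set (Fin d → ℤ)} {ℓ : ℤ → ℕ}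
  {a b a' b' : Fin d → ℤ} (h : IsAdmissibleInterval k s U ℓ a b)

/-- The scalar by which an endomorphism of an interval module acts on the top. -/
def topScalar (e : intervalModule h ⟶ intervalModule h) : k :=
  value h (e.hom.hom (basisVector h b)) b

variable (hab : a ≤ b) (e : intervalModule h ⟶ intervalModule h)

include hab

theorem value_endomorphism_bottom :
    value h (e.hom.hom (basisVector h a)) a = topScalar h e := by
  rw [← morphism_smul_basisVector h hab a, map_smul, value_smul h _ _ ⟨le_rfl, hab⟩,
    Finset.sum_eq_single b, morphism_apply_self hab, one_mul, topScalar]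
  · intro y _ hy
    rw [mul_eq_zero, or_iff_not_imp_left]
    intro hne
    obtain ⟨t, ht, rfl⟩ := exists_of_morphism_apply_ne_zero hne
    refine absurd (funext fun i => ?_) hy
    linarith [congrFun ht i]
  · exact fun hb => absurd (Finset.mem_Icc.2 ⟨hab, le_rfl⟩) hb

theorem topScalar_eq_zero_of_intervalMap_comp (ha' : a' ≤ a)
    (h₁ : IsAdmissibleInterval k s U ℓ a' a) (h0 : intervalMap h₁ h ha' hab ≫ e = 0) :
    topScalar h e = 0 := by
  have hbasis : e.hom.hom ((intervalMap h₁ h ha' hab).hom.hom (basisVector h₁ a)) = 0 :=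
    congrArg (fun φ : intervalModule h₁ ⟶ intervalModule h => φ.hom.hom (basisVector h₁ a)) h0
  rw [intervalMap_basisVector h₁ h ha' hab ⟨ha', le_rfl⟩] at hbasis
  rw [← value_endomorphism_bottom h hab e, hbasis, map_zero, Pi.zero_apply]

theorem topScalar_eq_zero_of_comp_intervalMap (hb' : b ≤ b')
    (h₂ : IsAdmissibleInterval k s U ℓ b b') (h0 : e ≫ intervalMap h h₂ hab hb' = 0) :
    topScalar h e = 0 := by
  have hbasis : (intervalMap h h₂ hab hb').hom.hom (e.hom.hom (basisVector h b)) = 0 :=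
    congrArg (fun φ : intervalModule h ⟶ intervalModule h₂ => φ.hom.hom (basisVector h b)) h0
  rw [topScalar, ← value_intervalMap h h₂ hab hb' _ ⟨le_rfl, hb'⟩, hbasis, map_zero,
    Pi.zero_apply]

variable [NeZero d]

theorem exists_of_value_endomorphism_ne_zero {v : (intervalModule h).obj} {u : Fin d → ℤ}
    (hu : value h (e.hom.hom v) u ≠ 0) :
    ∃ t : ℤ, t * s ≤ 0 ∧ value h v (fun i => u i - t * s) ≠ 0 ∧
      value h (e.hom.hom (basisVector h b)) (fun i => b i + t * s) ≠ 0 := by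
  have hum := mem_of_value_ne_zero hu
  rw [← ofFunction_value h v, ← column_smul_basisVector h hab, map_smul, value_smul h _ _ hum] at hu
  obtain ⟨y, hy, hne⟩ := Finset.exists_ne_zero_of_sum_ne_zero hu
  obtain ⟨t, rfl, hv⟩ := exists_of_column_apply_ne_zero (left_ne_zero_of_mul hne)
  exact ⟨t, by linarith [(Finset.mem_Icc.1 hy).2 0], hv, right_ne_zero_of_mul hne⟩

theorem le_of_value_endomorphism_basisVector_ne_zero {x u : Fin d → ℤ} (hx : x ∈ Set.Icc a b)
    (hu : value h (e.hom.hom (basisVector h x)) u ≠ 0) : u ≤ x := by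
  obtain ⟨t, ht, hv, -⟩ := exists_of_value_endomorphism_ne_zero h hab e hu
  rw [value_basisVector h hx] at hv
  have hux : (fun i => u i - t * s) = x := not_not.1 fun hne => hv (Pi.single_eq_of_ne hne _)
  exact fun i => by linarith [congrFun hux i]

theorem topScalar_ne_zero_of_idempotent (he : e ≫ e = e) (hne : e ≠ 0) : topScalar h e ≠ 0 := by
  intro h0
  obtain ⟨v, hv⟩ : ∃ v, e.hom.hom v ≠ 0 := by
    by_contra! hv
    exact hne (by ext v; exact hv v)
  have hfix : e.hom.hom (e.hom.hom v) = e.hom.hom v :=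
    congrArg (fun f : intervalModule h ⟶ intervalModule h => f.hom.hom v) he
  obtain ⟨x, hx⟩ := exists_value_ne_zero hv
  have hfin : {u | value h (e.hom.hom v) u ≠ 0}.Finite :=
    (Set.finite_Icc a b).subset fun u hu => mem_of_value_ne_zero hu
  obtain ⟨u, hu, hmax⟩ := Set.exists_max_image _ (fun u => u 0) hfin ⟨x, hx⟩
  rw [Set.mem_ofPred_eq, ← hfix] at hu
  obtain ⟨t, ht, hv', hb⟩ := exists_of_value_endomorphism_ne_zero h hab e hu
  have ht0 : t * s ≠ 0 := fun ht0 => hb (by simpa only [ht0, add_zero, topScalar] using h0)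
  have hle : u 0 - t * s ≤ u 0 := hmax _ hv'
  exact ht0 (le_antisymm ht (by linarith))

theorem intervalMap_comp_endomorphism_comp_intervalMap_eq_zero (hne : a ≠ b) (ha' : a' ≤ a)
    (hb' : b ≤ b') (h₁ : IsAdmissibleInterval k s U ℓ a' a)
    (h₂ : IsAdmissibleInterval k s U ℓ b b') :
    intervalMap h₁ h ha' hab ≫ e ≫ intervalMap h h₂ hab hb' = 0 := by
  refine hom_ext_of_basisVector h₁ ha' (value_ext (h := h₂) fun u hu => ?_)
  refine (value_intervalMap h h₂ hab hb' (e.hom.hom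
    ((intervalMap h₁ h ha' hab).hom.hom (basisVector h₁ a))) hu).trans ?_
  refine Eq.trans ?_ (congrFun (map_zero (value h₂)) u).symm
  rw [intervalMap_basisVector h₁ h ha' hab ⟨ha', le_rfl⟩]
  by_contra hvalue
  exact hne (le_antisymm hab (hu.1.trans
    (le_of_value_endomorphism_basisVector_ne_zero h hab e ⟨le_rfl, hab⟩ hvalue)))

theorem IsSchurSimple.eq_of_retract_intervalModule
    {P : ObjectProperty (FinMod k (QuotientAlgebra k d s U ℓ))} {X : P.FullSubcategory}
    (hX : IsSchurSimple X) (ρ : Retract X.obj (intervalModule h)) (ha' : a' ≤ a) (hb' : b ≤ b')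
    (h₁ : IsAdmissibleInterval k s U ℓ a' a) (h₂ : IsAdmissibleInterval k s U ℓ b b')
    (hP₁ : P (intervalModule h₁)) (hP₂ : P (intervalModule h₂)) : a = b := by
  by_contra hne
  let e : intervalModule h ⟶ intervalModule h := ρ.r ≫ ρ.i
  have htop : topScalar h e ≠ 0 := by
    refine topScalar_ne_zero_of_idempotent h hab e (by simp [e]) fun h0 => hX.1 ?_
    refine (IsZero.iff_id_eq_zero X).2 (InducedCategory.hom_ext ?_)
    calc 𝟙 X.obj = ρ.i ≫ e ≫ ρ.r := by simp [e]
      _ = 0 := by rw [h0, zero_comp, comp_zero]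
  let f : (⟨_, hP₁⟩ : P.FullSubcategory) ⟶ X := P.homMk (intervalMap h₁ h ha' hab ≫ ρ.r)
  let g : X ⟶ (⟨_, hP₂⟩ : P.FullSubcategory) := P.homMk (ρ.i ≫ intervalMap h h₂ hab hb')
  have hfg : f ≫ g = 0 := InducedCategory.hom_ext (by
    simpa [f, g, e] using intervalMap_comp_endomorphism_comp_intervalMap_eq_zero h hab e hne ha'
      hb' h₁ h₂)
  rcases hX.eq_zero_or_eq_zero_of_comp_eq_zero hfg with h0 | h0
  · have hf : intervalMap h₁ h ha' hab ≫ ρ.r = 0 := congrArg InducedCategory.Hom.hom h0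
    refine htop (topScalar_eq_zero_of_intervalMap_comp h hab e ha' h₁ ?_)
    rw [← Category.assoc, hf, zero_comp]
  · have hg : ρ.i ≫ intervalMap h h₂ hab hb' = 0 := congrArg InducedCategory.Hom.hom h0
    refine htop (topScalar_eq_zero_of_comp_intervalMap h hab e hb' h₂ ?_)
    rw [Category.assoc, hg, comp_zero]

end Endomorphisms

section Syzygies

theorem extDim_of_interval_resolution {k : Type u} [Field k] {d : ℕ} {s : ℤ}
    {U : Set (Fin d → ℤ)} {ℓ : ℤ → ℕ} (N : ℕ) (a b : ℕ → Fin d → ℤ)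
    (hK : ∀ j ≤ N, IsAdmissibleInterval k s U ℓ (a j) (b j))
    (hP : ∀ j < N, IsAdmissibleInterval k s U ℓ (a (j + 1)) (b j))
    (hab : ∀ j ≤ N, a j ≤ b j) (ha : ∀ j < N, a (j + 1) ≤ a j) (hb : ∀ j < N, b (j + 1) < b j)
    (hsplit : ∀ j < N, ∀ x ∈ Set.Icc (a (j + 1)) (b j), x ≤ b (j + 1) ↔ ¬ a j ≤ x)
    (hproj : ∀ j < N, IsProjectiveInterval k s U ℓ (a (j + 1)) (b j))
    {c : Fin d → ℤ} (hc : IsAdmissibleInterval k s U ℓ c c) (r j : ℕ) (hrj : r + j = N) :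
    extDim k r (intervalModule (hK j (by omega))) (intervalModule hc) =
      extDim k 0 (intervalModule (hK N le_rfl)) (intervalModule hc) := by
  induction r generalizing j with
  | zero =>
    obtain rfl : j = N := by omega
    rfl
  | succ r ih =>
    have hj : j < N := by omega
    rw [← ih (j + 1) (by omega)]
    obtain ⟨w, hS⟩ := intervalMap_shortExact (hK (j + 1) hj) (hK j hj.le) (ha j hj) (hb j hj).le
      (hP j hj) (hsplit j hj)
    have : Projective (intervalModule (hP j hj)) := (hproj j hj).projective (hP j hj)
    exact extDim_succ_of_shortExact k hS (intervalModule hc) r fun _ φ =>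
      intervalMap_comp_hom_onePoint_eq_zero (hK (j + 1) hj) (hP j hj) (hab (j + 1) hj) (hb j hj)
        hc φ

variable {d : ℕ} (i : ℤ) {m : ℤ}

/-- The sequence `λ = (i, …, i, i - 1, …, i - 1, m)` of length `d + 1`, with `j` entries `i - 1`.
For `m = i - ℓ_i + 1` and `j < d` the modules `M_λ` are the terms of the minimal projective
resolution of the simple module at `(i, …, i)`. -/
def resolutionSequence (d : ℕ) (i m : ℤ) (j : ℕ) : Fin (d + 1) → ℤ :=
  fun p => if p.1 = d then m else if p.1 + j < d then i else i - 1

/-- The vertex `(i, …, i, i - 1, …, i - 1)` of `ℤ^d` with `j` entries `i - 1`: the upper end of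
the support of the `j`-th syzygy of the simple module at `(i, …, i)`. -/
def syzygyTop (d : ℕ) (i : ℤ) (j : ℕ) : Fin d → ℤ :=
  fun p => if p.1 + j < d then i else i - 1

/-- The lower end of the support of the `j`-th syzygy of the simple module at `(i, …, i)`:
the vertex `(i, …, i, i - 1, …, i - 1, m)` of `ℤ^d` with `j - 1` entries `i - 1` if `j ≠ 0`, and
`(i, …, i)` if `j = 0`. -/
def syzygyBot (d : ℕ) (i m : ℤ) (j : ℕ) : Fin d → ℤ :=
  fun p => if j ≠ 0 ∧ p.1 + 1 = d then m else syzygyTop d i j p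

theorem init_resolutionSequence (d : ℕ) (i m : ℤ) (j : ℕ) :
    Fin.init (resolutionSequence d i m j) = syzygyTop d i j :=
  funext fun p => if_neg p.2.ne

theorem tail_resolutionSequence (d : ℕ) (i m : ℤ) (j : ℕ) :
    Fin.tail (resolutionSequence d i m j) = syzygyBot d i m (j + 1) := by
  funext p
  simp only [Fin.tail, resolutionSequence, syzygyBot, syzygyTop, Fin.val_succ]
  split_ifs <;> omega

theorem antitone_resolutionSequence (hm : m ≤ i - 1) (j : ℕ) :
    Antitone (resolutionSequence d i m j) := by
  intro p q hpq
  have : p.1 ≤ q.1 := hpq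
  simp only [resolutionSequence]
  split_ifs <;> omega

theorem resolutionSequence_zero [NeZero d] (m : ℤ) {j : ℕ} (hj : j < d) :
    resolutionSequence d i m j 0 = i :=
  (if_neg (NeZero.ne' d)).trans (if_pos (by simpa only [Fin.val_zero, zero_add] using hj))

theorem resolutionSequence_top (d : ℕ) (i m : ℤ) (j : ℕ) : resolutionSequence d i m j ⊤ = m :=
  if_pos rfl

theorem syzygyTop_zero (d : ℕ) (i : ℤ) : syzygyTop d i 0 = fun _ => i :=
  funext fun p => if_pos p.2

theorem syzygyBot_zero (d : ℕ) (i m : ℤ) : syzygyBot d i m 0 = fun _ => i :=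
  funext fun p => (if_neg fun h => h.1 rfl).trans (if_pos p.2)

theorem syzygyTop_self (d : ℕ) (i : ℤ) : syzygyTop d i d = fun _ => i - 1 :=
  funext fun _ => if_neg (by omega)

theorem syzygyTop_succ_le (j : ℕ) : syzygyTop d i (j + 1) ≤ syzygyTop d i j := by
  intro p
  simp only [syzygyTop]
  split_ifs <;> omega

theorem syzygyBot_le_syzygyTop (hm : m ≤ i - 1) (j : ℕ) :
    syzygyBot d i m j ≤ syzygyTop d i j := by
  intro p
  simp only [syzygyBot, syzygyTop]
  split_ifs <;> omega

theorem syzygyBot_succ_le (hm : m ≤ i - 1) (j : ℕ) :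
    syzygyBot d i m (j + 1) ≤ syzygyBot d i m j := by
  intro p
  simp only [syzygyBot, syzygyTop]
  split_ifs <;> omega

theorem le_syzygyTop_succ_iff {j : ℕ} {q : Fin d} (hq : q.1 + j + 1 = d) {x : Fin d → ℤ}
    (hx : x ≤ syzygyTop d i j) : x ≤ syzygyTop d i (j + 1) ↔ x q < i := by
  simp only [Pi.le_def, syzygyTop] at hx ⊢
  refine ⟨fun h => ?_, fun h p => ?_⟩
  · have hxq := h q
    rw [if_neg (by omega)] at hxq
    omega
  · have hxp := hx p
    by_cases hp : p = q
    · subst hp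
      rw [if_neg (by omega)]
      omega
    · have hp' : p.1 ≠ q.1 := fun h => hp (Fin.ext h)
      split_ifs at hxp ⊢ <;> omega

theorem syzygyBot_le_iff {j : ℕ} {q : Fin d} (hq : q.1 + j + 1 = d) {x : Fin d → ℤ}
    (hx : syzygyBot d i m (j + 1) ≤ x) : syzygyBot d i m j ≤ x ↔ i ≤ x q := by
  simp only [Pi.le_def, syzygyBot, syzygyTop] at hx ⊢
  refine ⟨fun h => ?_, fun h p => ?_⟩
  · have hxq := h q
    rwa [if_neg (by omega), if_pos (by omega)] at hxq
  · have hxp := hx p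
    by_cases hp : p = q
    · subst hp
      rwa [if_neg (by omega), if_pos (by omega)]
    · have hp' : p.1 ≠ q.1 := fun h => hp (Fin.ext h)
      split_ifs at hxp ⊢ <;> omega

theorem syzygyTop_succ_lt {j : ℕ} (hj : j < d) : syzygyTop d i (j + 1) < syzygyTop d i j := by
  obtain ⟨q, hq⟩ : ∃ q : Fin d, q.1 + j + 1 = d := ⟨⟨d - 1 - j, by omega⟩, by simp only; omega⟩
  refine lt_of_le_not_ge (syzygyTop_succ_le i j) fun h => ?_
  have hlt := (le_syzygyTop_succ_iff i hq le_rfl).1 h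
  rw [syzygyTop, if_pos (by omega)] at hlt
  exact lt_irrefl i hlt

theorem le_syzygyTop_succ_iff_not_syzygyBot_le {j : ℕ} (hj : j < d) {x : Fin d → ℤ}
    (hx : x ∈ Set.Icc (syzygyBot d i m (j + 1)) (syzygyTop d i j)) :
    x ≤ syzygyTop d i (j + 1) ↔ ¬ syzygyBot d i m j ≤ x := by
  obtain ⟨q, hq⟩ : ∃ q : Fin d, q.1 + j + 1 = d := ⟨⟨d - 1 - j, by omega⟩, by simp only; omega⟩
  rw [le_syzygyTop_succ_iff i hq hx.2, syzygyBot_le_iff i hq hx.1, not_le]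

end Syzygies

section NakayamaRange

theorem tail_le_init {d : ℕ} {l : Fin (d + 1) → ℤ} (hl : Antitone l) : Fin.tail l ≤ Fin.init l :=
  fun p => hl (Fin.castSucc_le_succ p)

variable {n : ℕ} [NeZero n] {ℓ : Fin n → ℕ}

theorem one_le_periodicExt (hℓ : IsKupisch ℓ) (i : ℤ) : 1 ≤ periodicExt ℓ i := by
  unfold periodicExt
  generalize (⟨(i % n).toNat, _⟩ : Fin n) = j
  by_cases hj : j = 0
  · exact hj ▸ hℓ.pos
  · exact one_le_two.trans (hℓ.two_le j hj)

/-- The sequences in `osCyc d ℓ` whose entries lie in the order-connected set `I`; this treats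
`osLin` (`I = [0, n - 1]`) and `osCyc` (`I = ℤ`) alike. -/
def osIn (d : ℕ) [NeZero d] (ℓ : Fin n → ℕ) (I : Set ℤ) : Set (Fin d → ℤ) :=
  {μ | μ ∈ osCyc d ℓ ∧ μ 0 ∈ I ∧ μ ⊤ ∈ I}

/-- The vertices `I` of a Nakayama algebra with Kupisch series `ℓ`, before passing to orbits under
translation by `s`: both `I` and `ℓ` are invariant under the translation, and `I` contains the
socle `i - ℓ_i + 1` of the projective at each vertex `i` of `I`. -/
structure IsNakayamaRange (ℓ : Fin n → ℕ) (s : ℤ) (I : Set ℤ) : Prop where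
  periodicExt_add_mul : ∀ i t : ℤ, periodicExt ℓ (i + t * s) = periodicExt ℓ i
  add_mul_mem : ∀ ⦃i⦄, i ∈ I → ∀ t : ℤ, i + t * s ∈ I
  sub_periodicExt_add_one_mem : ∀ ⦃i⦄, i ∈ I → i - periodicExt ℓ i + 1 ∈ I

variable {d : ℕ} [NeZero d] {s : ℤ} {I : Set ℤ}

theorem const_mem_osIn (hℓ : IsKupisch ℓ) {i : ℤ} (hi : i ∈ I) : (fun _ => i) ∈ osIn d ℓ I := by
  refine ⟨⟨antitone_const, ?_⟩, hi, hi⟩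
  rw [sub_self, zero_add]
  exact_mod_cast one_le_periodicExt hℓ i

theorem mem_osIn_of_mem_interval [I.OrdConnected] (hℓ : IsKupisch ℓ) {l : Fin (d + 1) → ℤ}
    (hl : l ∈ osIn (d + 1) ℓ I) {x : Fin d → ℤ} (hx : x ∈ Set.Icc (Fin.tail l) (Fin.init l)) :
    x ∈ osIn d ℓ I := by
  obtain ⟨hx0, hxtop, hxℓ⟩ := interval_bounds d hℓ hl.1.2 hx
  have hanti : Antitone x := mem_os_of_mem_interval d hx
  have hIcc : Set.Icc (l ⊤) (l 0) ⊆ I := Set.Icc_subset I hl.2.2 hl.2.1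
  have htop : x ⊤ ≤ x 0 := hanti le_top
  exact ⟨⟨hanti, hxℓ⟩, hIcc ⟨hxtop.trans htop, hx0⟩, hIcc ⟨hxtop, htop.trans hx0⟩⟩

theorem isAdmissibleInterval_osIn [I.OrdConnected] (k : Type u) [Field k] (s : ℤ)
    (hℓ : IsKupisch ℓ) {l : Fin (d + 1) → ℤ} (hl : l ∈ osIn (d + 1) ℓ I) :
    IsAdmissibleInterval k s (osIn d ℓ I) (periodicExt ℓ) (Fin.tail l) (Fin.init l) :=
  isAdmissibleInterval k d hℓ s _ l hl.1.2 fun _ hx => mem_osIn_of_mem_interval hℓ hl hx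

namespace IsNakayamaRange

variable (hI : IsNakayamaRange ℓ s I) {k : Type u} [Field k]

include hI

theorem mem_osIn_of_isTranslate ⦃x y : Fin d → ℤ⦄ (hxy : IsTranslate s x y)
    (hx : x ∈ osIn d ℓ I) : y ∈ osIn d ℓ I := by
  obtain ⟨t, rfl⟩ := hxy
  refine ⟨⟨fun p q hpq => add_le_add_left (hx.1.1 hpq) _, ?_⟩, hI.add_mul_mem hx.2.1 t,
    hI.add_mul_mem hx.2.2 t⟩
  rw [hI.periodicExt_add_mul, add_sub_add_right_eq_sub]
  exact hx.1.2

theorem isProjectiveInterval {l : Fin (d + 1) → ℤ} (hl : Antitone l)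
    (htop : l ⊤ = l 0 - periodicExt ℓ (l 0) + 1) :
    IsProjectiveInterval k s (osIn d ℓ I) (periodicExt ℓ) (Fin.tail l) (Fin.init l) := by
  refine ⟨tail_le_init hl, fun q => ?_⟩
  have hle : Function.update (Fin.init l) q (Fin.tail l q - 1) ≤ Fin.init l :=
    update_le_self_iff.2 (by linarith [tail_le_init hl q])
  obtain ⟨e, rfl⟩ := Nat.exists_eq_succ_of_ne_zero (NeZero.ne d)
  induction q using Fin.lastCases with
  | cast q =>
    refine toQuotient_morphism_eq_zero_of_notMem hI.mem_osIn_of_isTranslate hle fun hmem => ?_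
    have hanti := hmem.1.1 (Fin.castSucc_le_succ q)
    rw [Function.update_self, Function.update_of_ne (Fin.castSucc_lt_succ).ne'] at hanti
    have heq : Fin.tail l q.castSucc = Fin.init l q.succ := rfl
    linarith
  | last =>
    have hlast : Fin.tail l (Fin.last e) = l ⊤ := rfl
    by_cases he : e = 0
    · subst he
      refine toQuotient_morphism_eq_zero_of_path rfl hI.periodicExt_add_mul fun p => ?_
      obtain rfl : p = Fin.last 0 := Subsingleton.elim _ _
      have hinit : Fin.init l (Fin.last 0) = l 0 := rfl
      rw [Function.update_self, hlast, hinit]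
      linarith
    · refine toQuotient_morphism_eq_zero_of_notMem hI.mem_osIn_of_isTranslate hle fun hmem => ?_
      have hbound := hmem.1.2
      have hne : (0 : Fin (e + 1)) ≠ Fin.last e := fun h => he (congrArg Fin.val h).symm
      have hinit : Fin.init l 0 = l 0 := rfl
      rw [Function.update_of_ne hne, hinit, Fin.top_eq_last, Function.update_self, hlast] at hbound
      linarith

theorem resolutionSequence_mem_osIn {i : ℤ} (hiI : i ∈ I) (hi2 : 2 ≤ periodicExt ℓ i) {j : ℕ}
    (hj : j < d) : resolutionSequence d i (i - periodicExt ℓ i + 1) j ∈ osIn (d + 1) ℓ I := by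
  have h0 := resolutionSequence_zero i (i - periodicExt ℓ i + 1) hj
  have htop := resolutionSequence_top d i (i - periodicExt ℓ i + 1) j
  refine ⟨⟨antitone_resolutionSequence i (by omega) j, ?_⟩, ?_, ?_⟩
  · rw [h0, htop]
    linarith
  · rwa [h0]
  · rw [htop]
    exact hI.sub_periodicExt_add_one_mem hiI

variable {i : ℤ} {c : Fin d → ℤ}
  (hi : IsAdmissibleInterval k s (osIn d ℓ I) (periodicExt ℓ) (fun _ => i) (fun _ => i))
  (hc : IsAdmissibleInterval k s (osIn d ℓ I) (periodicExt ℓ) c c)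

theorem extDim_onePoint_of_eq_one (hi1 : periodicExt ℓ i = 1) :
    extDim k d (intervalModule hi) (intervalModule hc) = 0 := by
  have hproj : IsProjectiveInterval k s (osIn d ℓ I) (periodicExt ℓ) (fun _ => i) (fun _ => i) :=
    hI.isProjectiveInterval (l := fun _ => i) antitone_const (by simp [hi1])
  have : Projective (intervalModule hi) := hproj.projective hi
  obtain ⟨e, rfl⟩ := Nat.exists_eq_succ_of_ne_zero (NeZero.ne d)
  exact extDim_succ_of_projective k _ _ e

open scoped Classical in
theorem extDim_onePoint_of_two_le [I.OrdConnected] (hℓ : IsKupisch ℓ) (hiI : i ∈ I)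
    (hi2 : 2 ≤ periodicExt ℓ i) : extDim k d (intervalModule hi) (intervalModule hc) =
      if IsTranslate s (fun _ => i - 1) c then 1 else 0 := by
  obtain ⟨m, hm⟩ : ∃ m : ℤ, m = i - periodicExt ℓ i + 1 := ⟨_, rfl⟩
  have hmi : m ≤ i - 1 := by omega
  have hmem : ∀ j < d, resolutionSequence d i m j ∈ osIn (d + 1) ℓ I := fun j hj =>
    hm ▸ hI.resolutionSequence_mem_osIn hiI hi2 hj
  have hP : ∀ j < d, IsAdmissibleInterval k s (osIn d ℓ I) (periodicExt ℓ)
      (syzygyBot d i m (j + 1)) (syzygyTop d i j) := fun j hj => by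
    simpa only [tail_resolutionSequence, init_resolutionSequence] using
      isAdmissibleInterval_osIn k s hℓ (hmem j hj)
  have hproj : ∀ j < d, IsProjectiveInterval k s (osIn d ℓ I) (periodicExt ℓ)
      (syzygyBot d i m (j + 1)) (syzygyTop d i j) := fun j hj => by
    simpa only [tail_resolutionSequence, init_resolutionSequence] using
      hI.isProjectiveInterval (k := k) (hmem j hj).1.1
        (by rw [resolutionSequence_top, resolutionSequence_zero i m hj, hm])
  have hK : ∀ j ≤ d, IsAdmissibleInterval k s (osIn d ℓ I) (periodicExt ℓ) (syzygyBot d i m j)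
      (syzygyTop d i j) := fun j hj => by
    rcases Nat.eq_zero_or_pos j with rfl | hj0
    · simpa only [syzygyBot_zero, syzygyTop_zero] using hi
    · obtain ⟨e, rfl⟩ := Nat.exists_eq_succ_of_ne_zero hj0.ne'
      exact (hP e hj).mono le_rfl (syzygyTop_succ_le i e)
  have hres := extDim_of_interval_resolution d (syzygyBot d i m) (syzygyTop d i) hK hP
    (fun j _ => syzygyBot_le_syzygyTop i hmi j) (fun j _ => syzygyBot_succ_le i hmi j)
    (fun j hj => syzygyTop_succ_lt i hj)
    (fun j hj x hx => le_syzygyTop_succ_iff_not_syzygyBot_le i hj hx) hproj hc d 0 (add_zero d)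
  simp only [syzygyBot_zero, syzygyTop_zero] at hres
  rw [hres, extDim_zero, rank_hom_onePoint (hK d le_rfl) (syzygyBot_le_syzygyTop i hmi d),
    syzygyTop_self]
  split_ifs <;> simp only [Cardinal.lift_one, Cardinal.lift_zero]

open scoped Classical in
theorem extDim_onePoint [I.OrdConnected] (hℓ : IsKupisch ℓ) (hiI : i ∈ I) :
    extDim k d (intervalModule hi) (intervalModule hc) =
      if 2 ≤ periodicExt ℓ i ∧ IsTranslate s (fun _ => i - 1) c then 1 else 0 := by
  rcases (one_le_periodicExt hℓ i).eq_or_lt with hi1 | hi2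
  · rw [hI.extDim_onePoint_of_eq_one hi hc hi1.symm, if_neg fun h => by omega]
  · rw [hI.extDim_onePoint_of_two_le hi hc hℓ hiI hi2]
    simp only [show 2 ≤ periodicExt ℓ i from hi2, true_and]

end IsNakayamaRange

end NakayamaRange

section ConstantSequences

variable {n : ℕ} [NeZero n] {ℓ : Fin n → ℕ} {d : ℕ} {I : Set ℤ} [I.OrdConnected]

theorem comp_succ_mem_osIn (hℓ : IsKupisch ℓ) {l : Fin (d + 1) → ℤ}
    (hl : l ∈ osIn (d + 1) ℓ I) : l ∘ Order.succ ∈ osIn (d + 1) ℓ I := by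
  have htop : (l ∘ Order.succ) ⊤ = l ⊤ := congrArg l Order.succ_top
  have hle : (l ∘ Order.succ) 0 ≤ l 0 := hl.1.1 (Fin.zero_le _)
  have hge : l ⊤ ≤ (l ∘ Order.succ) 0 := hl.1.1 le_top
  have hmono := sub_periodicExt_mono hℓ hle
  refine ⟨⟨hl.1.1.comp_monotone Order.succ_mono, ?_⟩,
    Set.Icc_subset I hl.2.2 hl.2.1 ⟨hge, hle⟩, htop ▸ hl.2.2⟩
  have hbound := hl.1.2
  simp only at hmono
  rw [htop]
  linarith

theorem comp_pred_mem_osIn {l : Fin (d + 1) → ℤ} (hl : l ∈ osIn (d + 1) ℓ I) :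
    l ∘ Order.pred ∈ osIn (d + 1) ℓ I := by
  have hzero : (l ∘ Order.pred) 0 = l 0 := rfl
  have hle : (l ∘ Order.pred) ⊤ ≤ l 0 := hl.1.1 (Fin.zero_le _)
  have hge : l ⊤ ≤ (l ∘ Order.pred) ⊤ := hl.1.1 le_top
  refine ⟨⟨hl.1.1.comp_monotone Order.pred_mono, ?_⟩, hl.2.1,
    Set.Icc_subset I hl.2.2 hl.2.1 ⟨hge, hle⟩⟩
  have hbound := hl.1.2
  rw [hzero]
  linarith

theorem eq_const_of_tail_eq_init {l : Fin (d + 1) → ℤ} (h : Fin.tail l = Fin.init l) :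
    l = fun _ => l 0 := by
  funext p
  induction p using Fin.induction with
  | zero => rfl
  | succ p ih => exact (congrFun h p).trans ih

end ConstantSequences

section Classification

variable {n : ℕ} [NeZero n] {ℓ : Fin n → ℕ} (k : Type u) [Field k] (d : ℕ) [NeZero d] (s : ℤ)
  (I : Set ℤ) [I.OrdConnected] (hℓ : IsKupisch ℓ)

/-- The additive hull of the interval modules `M_λ` with `λ ∈ osIn (d + 1) ℓ I`; this treats
`linClusterTilting` and `cycClusterTilting` alike. -/
def clusterTilting :
    ObjectProperty (FinMod k (QuotientAlgebra k d s (osIn d ℓ I) (periodicExt ℓ))) :=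
  addHull fun l : osIn (d + 1) ℓ I => intervalModule (isAdmissibleInterval_osIn k s hℓ l.2)

variable {k d s I hℓ}

theorem clusterTilting_intervalModule {l : Fin (d + 1) → ℤ} (hl : l ∈ osIn (d + 1) ℓ I)
    {a b : Fin d → ℤ} (ha : Fin.tail l = a) (hb : Fin.init l = b)
    (h : IsAdmissibleInterval k s (osIn d ℓ I) (periodicExt ℓ) a b) :
    clusterTilting k d s I hℓ (intervalModule h) := by
  subst ha hb
  exact addHull_apply (fun l : osIn (d + 1) ℓ I =>
    intervalModule (isAdmissibleInterval_osIn k s hℓ l.2)) ⟨l, hl⟩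

variable (k s hℓ)

/-- The simple module at the vertex `(i, …, i)` as an object of the cluster tilting subcategory. -/
def simpleObject (i : I) : (clusterTilting k d s I hℓ).FullSubcategory :=
  ⟨intervalModule (isAdmissibleInterval_osIn k s hℓ (const_mem_osIn hℓ i.2)),
    clusterTilting_intervalModule (const_mem_osIn hℓ i.2) rfl rfl _⟩

variable {k s hℓ}

theorem isSchurSimple_simpleObject (i : I) : IsSchurSimple (simpleObject k (d := d) s hℓ i) :=
  isSchurSimple_onePoint (a := fun _ => i.1)
    (isAdmissibleInterval_osIn k s hℓ (const_mem_osIn hℓ i.2)) _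

theorem nonempty_iso_simpleObject_iff {i j : I} :
    Nonempty (simpleObject k (d := d) s hℓ i ≅ simpleObject k s hℓ j) ↔ ∃ t : ℤ, j = i + t * s := by
  constructor
  · rintro ⟨e⟩
    obtain ⟨t, ht⟩ := isTranslate_of_iso_onePoint (a := fun _ => i.1) (c := fun _ => j.1) _ _
      ((ObjectProperty.ι _).mapIso e)
    exact ⟨t, congrFun ht 0⟩
  · rintro ⟨t, ht⟩
    obtain ⟨e⟩ := nonempty_iso_onePoint (a := fun _ => i.1) (c := fun _ => j.1)
      (isAdmissibleInterval_osIn k s hℓ (const_mem_osIn (d := d + 1) hℓ i.2))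
      (isAdmissibleInterval_osIn k s hℓ (const_mem_osIn (d := d + 1) hℓ j.2))
      ⟨t, funext fun _ => ht⟩
    exact ⟨ObjectProperty.isoMk _ e⟩

theorem exists_iso_simpleObject_of_isSchurSimple
    {X : (clusterTilting k d s I hℓ).FullSubcategory} (hX : IsSchurSimple X) :
    ∃ i : I, Nonempty (simpleObject k s hℓ i ≅ X) := by
  obtain ⟨⟨l, hl⟩, ⟨ρ⟩⟩ := exists_retract_of_isSchurSimple_addHull _ k hX
  have hsucc := comp_succ_mem_osIn hℓ hl
  have hpred := comp_pred_mem_osIn hl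
  have hinit : Fin.init (l ∘ Order.succ) = Fin.tail l :=
    funext fun p => congrArg l (Fin.orderSucc_castSucc p)
  have h₁ := isAdmissibleInterval_osIn k s hℓ hsucc
  have hle₁ := tail_le_init hsucc.1.1
  rw [hinit] at h₁ hle₁
  have hconst : Fin.tail l = Fin.init l :=
    hX.eq_of_retract_intervalModule (isAdmissibleInterval_osIn k s hℓ hl) (tail_le_init hl.1.1) ρ
      hle₁ (tail_le_init hpred.1.1) h₁ (isAdmissibleInterval_osIn k s hℓ hpred)
      (clusterTilting_intervalModule hsucc rfl hinit h₁)
      (clusterTilting_intervalModule hpred rfl rfl _)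
  obtain ⟨i, rfl⟩ : ∃ i : ℤ, l = fun _ => i := ⟨l 0, eq_const_of_tail_eq_init hconst⟩
  have hX₀ : ¬ IsZero X.obj := fun h₀ => hX.1 <|
    (IsZero.iff_id_eq_zero X).2 (InducedCategory.hom_ext ((IsZero.iff_id_eq_zero _).1 h₀))
  obtain ⟨e⟩ := nonempty_iso_of_retract_onePoint (a := fun _ => i) hX₀
    (isAdmissibleInterval_osIn k s hℓ hl) ρ
  exact ⟨⟨i, hl.2.1⟩, ⟨ObjectProperty.isoMk _ e⟩⟩

end Classification

section QuiverIso

theorem nonempty_out_ite_equiv {α : Type*} [Subsingleton α] {p : Prop} [Decidable p]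
    (h : Nonempty α ↔ p) : Nonempty ((if p then 1 else 0 : Cardinal.{u}).out ≃ α) := by
  refine Cardinal.lift_mk_eq'.1 ?_
  rw [Cardinal.mk_out]
  split_ifs with hp
  · have : Nonempty α := h.2 hp
    rw [Cardinal.mk_eq_one, Cardinal.lift_one, Cardinal.lift_one]
  · have : IsEmpty α := not_nonempty_iff.1 (mt h.1 hp)
    rw [Cardinal.mk_eq_zero, Cardinal.lift_zero, Cardinal.lift_zero]

variable {n : ℕ} [NeZero n] {ℓ : Fin n → ℕ} {s : ℤ} {I : Set ℤ}

open scoped Classical in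
theorem IsNakayamaRange.extDim_simpleObject [I.OrdConnected] (hI : IsNakayamaRange ℓ s I)
    (hℓ : IsKupisch ℓ) (k : Type u) [Field k] {d : ℕ} [NeZero d] (i j : I) :
    extDim k d (simpleObject k (d := d) s hℓ i).obj (simpleObject k s hℓ j).obj =
      if 2 ≤ periodicExt ℓ i ∧ ∃ t : ℤ, (j : ℤ) = i - 1 + t * s then 1 else 0 := by
  have htranslate : IsTranslate s (fun _ : Fin d => (i : ℤ) - 1) (fun _ => (j : ℤ)) ↔
      ∃ t : ℤ, (j : ℤ) = i - 1 + t * s :=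
    exists_congr fun t => Function.const_inj
  exact (hI.extDim_onePoint (c := fun _ => (j : ℤ))
    (isAdmissibleInterval_osIn k s hℓ (const_mem_osIn (d := d + 1) hℓ i.2))
    (isAdmissibleInterval_osIn k s hℓ (const_mem_osIn (d := d + 1) hℓ j.2)) hℓ i.2).trans
    (if_congr (and_congr_right' htranslate) rfl rfl)

theorem IsNakayamaRange.nonempty_quiverIso [I.OrdConnected] (hI : IsNakayamaRange ℓ s I)
    (hℓ : IsKupisch ℓ) (k : Type u) [Field k] {d : ℕ} [NeZero d] {U : Set (Fin d → ℤ)}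
    {V : Set (Fin (d + 1) → ℤ)} (hU : U = osIn d ℓ I) (hV : V = osIn (d + 1) ℓ I)
    (adm : ∀ l : V, IsAdmissibleInterval k s U (periodicExt ℓ) (Fin.tail l.1) (Fin.init l.1))
    {W : Type*} [Quiver W] [Quiver.IsThin W] (σ : W → I)
    (inj : ∀ w w', ∀ t : ℤ, (σ w' : ℤ) = σ w + t * s → w = w')
    (surj : ∀ i : I, ∃ w, ∃ t : ℤ, (i : ℤ) = σ w + t * s)
    (arrows : ∀ w w', Nonempty (w ⟶ w') ↔
      2 ≤ periodicExt ℓ (σ w) ∧ ∃ t : ℤ, (σ w' : ℤ) = σ w - 1 + t * s) :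
    Nonempty (QuiverIso (ExtQuiver k d (addHull fun l : V => intervalModule (adm l))) W) := by
  classical
  subst hU hV
  refine ExtQuiver.nonempty_quiverIso (M := clusterTilting k d s I hℓ) k
    (S := fun w => simpleObject k s hℓ (σ w)) (fun w => isSchurSimple_simpleObject (σ w))
    (fun w w' hw => ?_) (fun X hX => ?_) fun w w' => ?_
  · obtain ⟨t, ht⟩ := nonempty_iso_simpleObject_iff.1 hw
    exact inj w w' t ht
  · obtain ⟨i, ⟨e⟩⟩ := exists_iso_simpleObject_of_isSchurSimple hX
    obtain ⟨w, hw⟩ := surj i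
    exact ⟨w, ⟨(nonempty_iso_simpleObject_iff.2 hw).some ≪≫ e⟩⟩
  · rw [hI.extDim_simpleObject hℓ k]
    exact nonempty_out_ite_equiv (arrows w w')

end QuiverIso

section Kupisch

theorem eq_of_sub_eq_sub_add_mul {n w w' : ℕ} (hw : w < n) (hw' : w' < n) {t : ℤ}
    (h : (n : ℤ) - 1 - w' = n - 1 - w + t * n) : w = w' := by
  have hmod : (w' : ℤ) ≡ w [ZMOD n] := Int.modEq_iff_dvd.2 ⟨t, by linarith⟩
  exact ((Int.natCast_modEq_iff.1 hmod).eq_of_lt_of_lt hw' hw).symm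

theorem add_one_mod_eq_iff_exists {n w w' : ℕ} (hw' : w' < n) :
    (w + 1) % n = w' ↔ ∃ t : ℤ, (n : ℤ) - 1 - w' = n - 1 - w - 1 + t * n := by
  have hmod : (w + 1) % n = w' ↔ w + 1 ≡ w' [MOD n] := by
    rw [Nat.ModEq, Nat.mod_eq_of_lt hw']
  rw [hmod, ← Int.natCast_modEq_iff, Int.modEq_comm, Int.modEq_iff_dvd]
  refine exists_congr fun t => ?_
  push_cast
  constructor <;> intro h <;> linarith

variable {n : ℕ} [NeZero n] {ℓ : Fin n → ℕ}

theorem periodicExt_zero : periodicExt ℓ 0 = ℓ 0 :=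
  rfl

theorem two_le_periodicExt_iff (hℓ : IsKupisch ℓ) {i : ℤ} :
    2 ≤ periodicExt ℓ i ↔ ((n : ℤ) ∣ i → ℓ 0 ≠ 1) := by
  have hn : (0 : ℤ) < n := by exact_mod_cast NeZero.pos n
  have hpos := hℓ.pos
  by_cases hi : (n : ℤ) ∣ i
  · have hzero : periodicExt ℓ i = ℓ 0 := by
      rw [← periodicExt_zero (ℓ := ℓ)]
      simp only [periodicExt, Int.emod_eq_zero_of_dvd hi, Int.zero_emod]
    rw [hzero]
    exact ⟨fun h _ => by omega, fun h => by have := h hi; omega⟩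
  · refine iff_of_true (hℓ.two_le _ fun h => hi ?_) fun h => absurd h hi
    have hmod : (i % n).toNat = 0 := congrArg Fin.val h
    exact Int.dvd_of_emod_eq_zero
      ((Int.toNat_eq_zero.1 hmod).antisymm (Int.emod_nonneg i hn.ne'))

theorem isNakayamaRange_Icc (hℓ : IsKupisch ℓ) (h0 : ℓ 0 = 1) :
    IsNakayamaRange ℓ 0 (Set.Icc 0 (n - 1)) where
  periodicExt_add_mul i t := by rw [mul_zero, add_zero]
  add_mul_mem i hi t := by rwa [mul_zero, add_zero]
  sub_periodicExt_add_one_mem i hi := by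
    have hmono := sub_periodicExt_mono hℓ hi.1
    have hpos := one_le_periodicExt hℓ i
    have hle := hi.2
    simp only [periodicExt_zero, h0] at hmono
    exact ⟨by omega, by omega⟩

theorem isNakayamaRange_univ : IsNakayamaRange ℓ n Set.univ where
  periodicExt_add_mul i t := by simp only [periodicExt, Int.add_mul_emod_self_right]
  add_mul_mem _ _ _ := Set.mem_univ _
  sub_periodicExt_add_one_mem _ _ := Set.mem_univ _

variable (ℓ) in
theorem osLin_eq_osIn (d : ℕ) [NeZero d] : osLin d ℓ = osIn d ℓ (Set.Icc 0 (n - 1)) := by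
  ext μ
  refine ⟨fun h => ?_, fun h => ⟨h.1.1, h.2.1.2, h.2.2.1, h.1.2⟩⟩
  have hle : μ ⊤ ≤ μ 0 := h.1 le_top
  exact ⟨⟨h.1, h.2.2.2⟩, ⟨h.2.2.1.trans hle, h.2.1⟩, ⟨h.2.2.1, hle.trans h.2.1⟩⟩

variable (ℓ) in
theorem osCyc_eq_osIn (d : ℕ) [NeZero d] : osCyc d ℓ = osIn d ℓ Set.univ :=
  Set.ext fun _ => ⟨fun h => ⟨h, Set.mem_univ _, Set.mem_univ _⟩, And.left⟩

instance (n : ℕ) : Quiver.IsThin (LinearQuiver n) :=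
  fun _ _ => inferInstanceAs (Subsingleton (PLift _))

instance (n : ℕ) : Quiver.IsThin (CyclicQuiver n) :=
  fun _ _ => inferInstanceAs (Subsingleton (PLift _))

variable (k : Type u) [Field k] (d : ℕ) [NeZero d]

theorem nonempty_quiverIso_linear (hℓ : IsKupisch ℓ) (h0 : ℓ 0 = 1) :
    Nonempty (QuiverIso (ExtQuiver k d (linClusterTilting k d hℓ)) (LinearQuiver n)) := by
  refine (isNakayamaRange_Icc hℓ h0).nonempty_quiverIso hℓ k (osLin_eq_osIn ℓ d)
    (osLin_eq_osIn ℓ (d + 1)) _ (W := LinearQuiver n)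
    (fun w : Fin n => ⟨n - 1 - w, by have := w.2; constructor <;> omega⟩)
    (fun (w w' : Fin n) t ht => ?_) (fun ⟨i, hi⟩ => ?_) fun (w w' : Fin n) => ?_
  · exact Fin.ext (by simp only [mul_zero] at ht; omega)
  · have hi₀ : 0 ≤ i := hi.1
    have hi₁ : i ≤ n - 1 := hi.2
    exact ⟨(⟨(n - 1 - i).toNat, by omega⟩ : Fin n), 0, by simp only; omega⟩
  · have hdvd : (n : ℤ) ∣ n - 1 - w ↔ (n : ℤ) - 1 - w = 0 :=
      ⟨fun h => Int.eq_zero_of_dvd_of_nonneg_of_lt (by omega) (by omega) h, fun h => h ▸ dvd_zero _⟩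
    simp only [two_le_periodicExt_iff hℓ, hdvd, h0, ne_eq, not_true_eq_false, imp_false, mul_zero,
      add_zero, exists_const]
    refine (nonempty_plift.trans nonempty_prop).trans ?_
    omega

theorem nonempty_quiverIso_cyclic (hℓ : IsKupisch ℓ) (h0 : ℓ 0 ≠ 1) :
    Nonempty (QuiverIso (ExtQuiver k d (cycClusterTilting k d hℓ)) (CyclicQuiver n)) := by
  refine isNakayamaRange_univ.nonempty_quiverIso hℓ k (osCyc_eq_osIn ℓ d)
    (osCyc_eq_osIn ℓ (d + 1)) _ (W := CyclicQuiver n)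
    (fun w : Fin n => ⟨n - 1 - w, Set.mem_univ _⟩)
    (fun (w w' : Fin n) t ht => ?_) (fun ⟨i, hi⟩ => ?_) fun (w w' : Fin n) => ?_
  · exact Fin.ext (eq_of_sub_eq_sub_add_mul w.2 w'.2 ht)
  · have hn : (0 : ℤ) < n := by exact_mod_cast NeZero.pos n
    have hi₀ := Int.emod_nonneg i hn.ne'
    have hi₁ := Int.emod_lt_of_pos i hn
    have hdiv := Int.emod_add_mul_ediv i n
    refine ⟨(⟨(n - 1 - i % n).toNat, by omega⟩ : Fin n), i / n, ?_⟩
    simp only [Int.toNat_of_nonneg (show 0 ≤ (n : ℤ) - 1 - i % n by omega)]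
    linarith
  · rw [and_iff_right ((two_le_periodicExt_iff hℓ).2 fun _ => h0)]
    exact (nonempty_plift.trans nonempty_prop).trans (add_one_mod_eq_iff_exists w'.2)

end Kupisch

end

end HigherNakayama

theorem mainTheorem2 (k : Type*) [Field k] (d n : ℕ) [NeZero d] [NeZero n]
    (ℓ : Fin n → ℕ) (hℓ : HigherNakayama.IsKupisch ℓ) :
    (ℓ 0 = 1 →
      Nonempty (HigherNakayama.QuiverIso
        (HigherNakayama.ExtQuiver k d (HigherNakayama.linClusterTilting k d hℓ))
        (HigherNakayama.LinearQuiver n))) ∧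
    (ℓ 0 ≠ 1 →
      Nonempty (HigherNakayama.QuiverIso
        (HigherNakayama.ExtQuiver k d (HigherNakayama.cycClusterTilting k d hℓ))
        (HigherNakayama.CyclicQuiver n))) :=
  ⟨HigherNakayama.nonempty_quiverIso_linear k d hℓ, HigherNakayama.nonempty_quiverIso_cyclic k d hℓ⟩
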